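/- **Theorem 1.** Let $U\subseteq\mathbb R^2$ be an open set containing $(x_0,0)$ and let $F(x,\varepsilon)$, $G(x,\varepsilon)$ be $C^\infty$ functions on $U$. Put $f(x)=F(x,0)$, $g(x)=G(x,0)$ and suppose that $f(x_0)=g(x_0)=0$. For $\varepsilon>0$ consider the system $$\dot x=y,\qquad \dot y=-F(x,\varepsilon)\,y-G(x,\varepsilon).\qquad (*)$$ Suppose that $$f''(x_0)g'(x_0)-g''(x_0)f'(x_0)<0,\qquad g'(x_0)>0,$$ and that for all sufficiently small $\varepsilon>0$ one has $F(x_\varepsilon,\varepsilon)>0$, where $x_\varepsilon$ is the zero of $G(\cdot,\varepsilon)$ near $x_0$, that is, $G(x_\varepsilon,\varepsilon)=0$ and $x_\varepsilon\to x_0$ as $\varepsilon\to0^+$. Then for every $r>0$ there is an $\varepsilon_0>0$ such that for every $\varepsilon\in(0,\varepsilon_0)$ the system $(*)$ has a cycle (the closed trajectory of a non-constant periodic solution) which is contained in the disc of radius $r$ around the equilibrium $(x_\varepsilon,0)$ and along which $(x,\varepsilon)$ stays in $U$. -/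

import Mathlib

open Set Filter Topology
open scoped ContDiff

/-- The planar vector field of the system `x' = y`, `y' = -F(x,ε) y - G(x,ε)`
at the parameter value `ε`. -/
def lienardField (F G : ℝ → ℝ → ℝ) (ε : ℝ) (p : ℝ × ℝ) : ℝ × ℝ :=
  (p.2, -F p.1 ε * p.2 - G p.1 ε)

/-- `C` is a cycle (closed trajectory) of the planar system `p' = X(p)`: the trajectory of a
non-constant periodic solution. -/
def IsCycle (X : ℝ × ℝ → ℝ × ℝ) (C : Set (ℝ × ℝ)) : Prop :=
  ∃ (γ : ℝ → ℝ × ℝ) (T : ℝ), 0 < T ∧ (∀ t : ℝ, HasDerivAt γ (X (γ t)) t) ∧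
    Function.Periodic γ T ∧ (∃ t : ℝ, γ t ≠ γ 0) ∧ C = Set.range γ

open scoped NNReal
open Asymptotics

/-! Put u = x - x₀ and write f = a u + b u² + …, g = w u + c u² + …. At ε = 0 the linear part is a
centre, and the sign condition says that l = (a c - b w)/w, the first Lyapunov coefficient up to a
positive factor, is positive. Hence a quartic correction of the energy strictly increases along
trajectories near the equilibrium (`eventually_focusLyapunov_deriv_pos`), and they cross a small
level curve of it outwards. Only a compact curve is involved, so this survives for small ε. For ε >
0, however, the positive damping at the equilibrium makes it attracting: a quadratic form decreases
there (`exists_quadratic_lyapunov`), and trajectories cross small ellipses inwards. In reversed time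
the region between ellipse and curve is forward invariant. The outer curve is fixed before ε, while
the ellipse may shrink with ε.

Rotation takes the place of Poincaré–Bendixson. Near the equilibrium F² < 2w and ∂G/∂x ≥ w/2, which
forces nonzero angular speed. The radius as a function of the angle then solves a scalar 2π-periodic
equation, and the intermediate value theorem gives a fixed point of its period map
(`exists_periodic_solution`). Running through the angle in the right time turns it into a cycle
(`exists_cycle_of_barriers`). -/

/-! ### Scalar equations with periodic coefficients -/

/-- A bounded, globally Lipschitz time-dependent field on the line has solutions on `[0, T]`. -/
theorem exists_solution_Icc {R : ℝ → ℝ → ℝ} {T B : ℝ} {K : ℝ≥0} (hT : 0 < T)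
    (hc : Continuous (Function.uncurry R)) (hK : ∀ t, LipschitzWith K (R t))
    (hB : ∀ t x, |R t x| ≤ B) (x : ℝ) :
    ∃ α : ℝ → ℝ, α 0 = x ∧ ∀ t ∈ Icc 0 T, HasDerivWithinAt α (R t (α t)) (Icc 0 T) t := by
  have hB0 : 0 ≤ B := (abs_nonneg _).trans (hB 0 0)
  -- In time `T` a solution moves by at most `B * T`, so a ball of that radius serves the whole
  -- interval.
  have h : IsPicardLindelof R (tmin := 0) (tmax := T) ⟨0, left_mem_Icc.2 hT.le⟩ x
      ⟨B * T, by positivity⟩ 0 ⟨B, hB0⟩ K :=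
    { lipschitzOnWith := fun t _ => (hK t).lipschitzOnWith
      continuousOn := fun y _ => by
        have : Continuous fun t => R t y := hc.comp (by fun_prop : Continuous fun t : ℝ => (t, y))
        exact this.continuousOn
      norm_le := fun t _ y _ => hB t y
      mul_max_le := by
        simp [hT.le]
        exact le_rfl }
  exact h.exists_eq_forall_mem_Icc_hasDerivWithinAt₀

theorem dist_solution_le {R : ℝ → ℝ → ℝ} {T : ℝ} {K : ℝ≥0} (hK : ∀ t, LipschitzWith K (R t))
    {α β : ℝ → ℝ} {s : ℝ} (hs : 0 ≤ s)
    (hα : ∀ t ∈ Icc 0 T, HasDerivWithinAt α (R t (α t)) (Icc 0 T) t)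
    (hβ : ∀ t ∈ Icc 0 T, HasDerivWithinAt β (R t (β t)) (Icc 0 T) t)
    {t : ℝ} (ht : t ∈ Icc s T) :
    dist (α t) (β t) ≤ dist (α s) (β s) * Real.exp (K * (t - s)) := by
  have key : ∀ {γ : ℝ → ℝ}, (∀ t ∈ Icc 0 T, HasDerivWithinAt γ (R t (γ t)) (Icc 0 T) t) →
      ContinuousOn γ (Icc s T) ∧
        ∀ t ∈ Ico s T, HasDerivWithinAt γ (R t (γ t)) (Ici t) t := by
    intro γ hγ
    refine ⟨fun t ht => ((hγ t ⟨hs.trans ht.1, ht.2⟩).continuousWithinAt).mono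
      (Icc_subset_Icc_left hs), fun t ht => ?_⟩
    refine ((hγ t ⟨hs.trans ht.1, ht.2.le⟩).mono
      (Icc_subset_Icc_left (hs.trans ht.1))).mono_of_mem_nhdsWithin ?_
    exact Icc_mem_nhdsGE ht.2
  exact dist_le_of_trajectories_ODE (v := R) hK (key hα).1 (key hα).2
    (key hβ).1 (key hβ).2 le_rfl t ht

/-- Solutions of a scalar equation do not cross. -/
theorem solution_le_solution {R : ℝ → ℝ → ℝ} {T : ℝ} {K : ℝ≥0}
    (hK : ∀ t, LipschitzWith K (R t)) {α β : ℝ → ℝ}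
    (hα : ∀ t ∈ Icc 0 T, HasDerivWithinAt α (R t (α t)) (Icc 0 T) t)
    (hβ : ∀ t ∈ Icc 0 T, HasDerivWithinAt β (R t (β t)) (Icc 0 T) t)
    (h0 : α 0 ≤ β 0) {t : ℝ} (ht : t ∈ Icc 0 T) : α t ≤ β t := by
  by_contra! hlt
  have hcont : ContinuousOn (fun s => β s - α s) (Icc 0 t) := fun s hs =>
    (((hβ s ⟨hs.1, hs.2.trans ht.2⟩).continuousWithinAt).sub
      ((hα s ⟨hs.1, hs.2.trans ht.2⟩).continuousWithinAt)).mono (Icc_subset_Icc_right ht.2)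
  -- If the order were reversed at `t`, the solutions would meet at some earlier `s`; Grönwall's
  -- estimate from `s` on makes them agree at `t`.
  obtain ⟨s, hs, hs0⟩ := intermediate_value_Icc' ht.1 hcont
    (show (0 : ℝ) ∈ Icc _ _ from ⟨by linarith, by linarith⟩)
  have := dist_solution_le hK hs.1 hα hβ ⟨hs.2, ht.2⟩
  have h2 : dist (α s) (β s) = 0 := by
    rw [dist_eq_zero]; simp only at hs0; linarith
  rw [h2, zero_mul] at this
  have := dist_le_zero.1 this
  linarith

/-- A solution on `[0, T]` of a `T`-periodic equation with equal end values extends to a periodic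
solution on the line. -/
theorem exists_periodic_extension {R : ℝ → ℝ → ℝ} {T : ℝ} (hT : 0 < T)
    (hc : Continuous (Function.uncurry R)) (hper : ∀ t x, R (t + T) x = R t x) {α : ℝ → ℝ}
    (hα : ∀ t ∈ Icc 0 T, HasDerivWithinAt α (R t (α t)) (Icc 0 T) t) (hend : α 0 = α T) :
    ∃ q : ℝ → ℝ, Function.Periodic q T ∧ (∀ t ∈ Icc 0 T, q t = α t) ∧
      ∀ t, HasDerivAt q (R t (q t)) t := by
  have : Fact (0 < T) := ⟨hT⟩
  have hαc : ContinuousOn α (Icc 0 T) := fun t ht => (hα t ht).continuousWithinAt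
  set q : ℝ → ℝ := fun t => AddCircle.liftIco T 0 α (t : AddCircle T) with hq
  have hqc : Continuous q := (AddCircle.liftIco_continuous (by simpa using hend)
    (by simpa using hαc)).comp (AddCircle.continuous_mk' T)
  have hqp : Function.Periodic q T := fun t => by simp [hq]
  have hq1 : ∀ t ∈ Ico 0 T, q t = α t := fun t ht => AddCircle.liftIco_zero_coe_apply ht
  have hq2 : ∀ t ∈ Icc 0 T, q t = α t := by
    intro t ht
    rcases ht.2.lt_or_eq with h | h
    · exact hq1 t ⟨ht.1, h⟩
    · have := hqp 0
      rw [zero_add] at this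
      rw [h, this, hq1 0 ⟨le_rfl, hT⟩, hend]
  have hkc : Continuous fun t => R t (q t) := hc.comp (by fun_prop : Continuous fun t => (t, q t))
  have hkp : Function.Periodic (fun t => R t (q t)) T := fun t => by
    simp only [hqp t, hper]
  -- Differentiability of the glued function at multiples of `T` is not evident. The integral of its
  -- continuous velocity is differentiable everywhere and turns out to equal it.
  set Q : ℝ → ℝ := fun t => α 0 + ∫ s in (0 : ℝ)..t, R s (q s) with hQ
  have hQd : ∀ t, HasDerivAt Q (R t (q t)) t := fun t =>
    (intervalIntegral.integral_hasDerivAt_right (hkc.intervalIntegrable _ _)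
      (hkc.stronglyMeasurableAtFilter _ _) hkc.continuousAt).const_add _
  have hQα : ∀ t ∈ Icc 0 T, Q t = α t := by
    intro t ht
    have : ∫ s in (0 : ℝ)..t, R s (q s) = α t - α 0 := by
      refine intervalIntegral.integral_eq_sub_of_hasDerivAt_of_le ht.1
        (hαc.mono (Icc_subset_Icc_right ht.2)) (fun s hs => ?_) (hkc.intervalIntegrable _ _)
      have hs' : s ∈ Icc 0 T := ⟨hs.1.le, hs.2.le.trans ht.2⟩
      rw [hq2 s hs']
      exact (hα s hs').hasDerivAt (Icc_mem_nhds hs.1 (hs.2.trans_le ht.2))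
    simp [hQ, this]
  have hQp : Function.Periodic Q T := by
    intro t
    have h1 : ∫ s in (0 : ℝ)..(t + T), R s (q s)
        = (∫ s in (0 : ℝ)..t, R s (q s)) + ∫ s in t..(t + T), R s (q s) :=
      (intervalIntegral.integral_add_adjacent_intervals (hkc.intervalIntegrable _ _)
        (hkc.intervalIntegrable _ _)).symm
    have h2 : ∫ s in t..(t + T), R s (q s) = ∫ s in (0 : ℝ)..(0 + T), R s (q s) :=
      hkp.intervalIntegral_add_eq t 0
    have h3 := hQα T ⟨hT.le, le_rfl⟩
    simp only [hQ, zero_add] at h3 h2 ⊢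
    rw [h1, h2]
    linarith
  have hQq : Q = q := by
    funext t
    have hy := toIcoMod_mem_Ico hT 0 t
    rw [zero_add] at hy
    rw [← toIcoMod_add_toIcoDiv_zsmul hT 0 t, hQp.zsmul _ _, hqp.zsmul _ _,
      hQα _ ⟨hy.1, hy.2.le⟩, hq1 _ hy]
  refine ⟨q, hqp, hq2, fun t => ?_⟩
  have := hQd t
  rwa [hQq] at this

/-- A scalar `T`-periodic equation whose period map sends a compact set into itself has a
periodic solution squeezed between two solutions which start in that set. -/
theorem exists_periodic_solution {R : ℝ → ℝ → ℝ} {T B : ℝ} {K : ℝ≥0} (hT : 0 < T)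
    (hc : Continuous (Function.uncurry R)) (hK : ∀ t, LipschitzWith K (R t))
    (hB : ∀ t x, |R t x| ≤ B) (hper : ∀ t x, R (t + T) x = R t x)
    {A : Set ℝ} (hA : IsCompact A) (hne : A.Nonempty) {m M : ℝ}
    (hinv : ∀ α : ℝ → ℝ, (∀ t ∈ Icc 0 T, HasDerivWithinAt α (R t (α t)) (Icc 0 T) t) →
      α 0 ∈ A → (∀ t ∈ Icc 0 T, α t ∈ Icc m M) ∧ α T ∈ A) :
    ∃ q : ℝ → ℝ, Function.Periodic q T ∧ (∀ t, q t ∈ Icc m M) ∧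
      ∀ t, HasDerivAt q (R t (q t)) t := by
  choose φ hφ0 hφ using exists_solution_Icc hT hc hK hB
  have hTT : T ∈ Icc 0 T := ⟨hT.le, le_rfl⟩
  have hcont : Continuous fun x => φ x T := by
    have : LipschitzWith (Real.exp (K * T)).toNNReal fun x => φ x T := by
      refine LipschitzWith.of_dist_le_mul fun x y => ?_
      have := dist_solution_le hK le_rfl (hφ x) (hφ y) hTT
      rw [hφ0, hφ0, sub_zero] at this
      rw [Real.coe_toNNReal _ (Real.exp_pos _).le, mul_comm]
      exact this
    exact this.continuous
  obtain ⟨a, ha, hamin⟩ := hA.exists_isLeast hne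
  obtain ⟨b, hb, hbmax⟩ := hA.exists_isGreatest hne
  have hab : a ≤ b := hamin hb
  obtain ⟨ha1, ha2⟩ := hinv (φ a) (hφ a) (by rwa [hφ0])
  obtain ⟨hb1, hb2⟩ := hinv (φ b) (hφ b) (by rwa [hφ0])
  -- `A` need not be an interval: its least point is not moved down and its greatest point not up,
  -- which suffices for a fixed point in between.
  obtain ⟨c, hcab, hc0⟩ := intermediate_value_Icc' hab
    (hcont.sub continuous_id).continuousOn
    (show (0 : ℝ) ∈ Icc _ _ from ⟨sub_nonpos.2 (hbmax hb2), sub_nonneg.2 (hamin ha2)⟩)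
  have hcT : φ c 0 = φ c T := by
    have : φ c T - c = 0 := hc0
    rw [hφ0]; linarith
  obtain ⟨q, hqp, hq, hqd⟩ := exists_periodic_extension hT hc hper (hφ c) hcT
  refine ⟨q, hqp, fun t => ?_, hqd⟩
  obtain ⟨y, hy, e⟩ := hqp.exists_mem_Ico₀ hT t
  have hy' : y ∈ Icc 0 T := ⟨hy.1, hy.2.le⟩
  rw [e, hq y hy']
  exact ⟨(ha1 y hy').1.trans (solution_le_solution hK (hφ a) (hφ c)
      (by rw [hφ0, hφ0]; exact hcab.1) hy'),
    (solution_le_solution hK (hφ c) (hφ b) (by rw [hφ0, hφ0]; exact hcab.2) hy').trans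
      (hb1 y hy').2⟩

/-- Inversion of the time `∫ 1/k`: an autonomous periodic positive scalar field has a global
solution which advances by one period in finite time. -/
theorem exists_angle_solution {k : ℝ → ℝ} {L : ℝ} (hL : 0 < L) (hk : Continuous k)
    (hpos : ∀ t, 0 < k t) (hper : Function.Periodic k L) :
    ∃ (φ : ℝ → ℝ) (T : ℝ), 0 < T ∧ (∀ t, HasDerivAt φ (k (φ t)) t) ∧
      ∀ t, φ (t + T) = φ t + L := by
  set g : ℝ → ℝ := fun s => (k s)⁻¹ with hg
  have hgc : Continuous g := hk.inv₀ fun s => (hpos s).ne'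
  have hgpos : ∀ s, 0 < g s := fun s => inv_pos.2 (hpos s)
  have hgper : Function.Periodic g L := fun s => by simp only [hg, hper s]
  have hint : ∀ a b, IntervalIntegrable g MeasureTheory.volume a b :=
    fun a b => hgc.intervalIntegrable a b
  set τ : ℝ → ℝ := fun t => ∫ s in (0 : ℝ)..t, g s with hτ
  have hτd : ∀ t, HasDerivAt τ (g t) t := fun t =>
    intervalIntegral.integral_hasDerivAt_right (hint _ _)
      (hgc.stronglyMeasurableAtFilter _ _) hgc.continuousAt
  have hτm : StrictMono τ := strictMono_of_hasDerivAt_pos hτd hgpos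
  have hτc : Continuous τ := continuous_iff_continuousAt.2 fun t => (hτd t).continuousAt
  have hτs : Function.Surjective τ := hτc.surjective
    (hgper.tendsto_atTop_intervalIntegral_of_pos' (hint _ _) hgpos hL)
    (hgper.tendsto_atBot_intervalIntegral_of_pos' (hint _ _) hgpos hL)
  set e := hτm.orderIsoOfSurjective τ hτs with he
  have heτ : ∀ t, e t = τ t := fun t => rfl
  have hadd : ∀ t, τ (t + L) = τ t + τ L := by
    intro t
    have h2 : ∫ s in t..(t + L), g s = ∫ s in (0 : ℝ)..(0 + L), g s :=
      hgper.intervalIntegral_add_eq t 0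
    rw [zero_add] at h2
    simp only [hτ]
    rw [← h2, intervalIntegral.integral_add_adjacent_intervals (hint _ _) (hint _ _)]
  refine ⟨e.symm, τ L, ?_, fun t => ?_, fun t => ?_⟩
  · have := hτm hL
    simpa [hτ] using this
  · have h1 : HasDerivAt τ (g (e.symm t)) (e.symm t) := hτd _
    have h2 := h1.of_local_left_inverse (g := e.symm) (a := t)
      e.symm.continuous.continuousAt (hgpos _).ne'
      (Eventually.of_forall fun s => by rw [← heτ, OrderIso.apply_symm_apply])
    simpa [hg] using h2
  · apply e.injective
    rw [OrderIso.apply_symm_apply, heτ, hadd, ← heτ (e.symm t), OrderIso.apply_symm_apply]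

/-! ### Barriers for scalar equations -/

theorem eventually_nonpos_of_hasDerivWithinAt {f : ℝ → ℝ} {f' x : ℝ}
    (hf : HasDerivWithinAt f f' (Ici x) x) (h0 : f x ≤ 0) (hneg : f x = 0 → f' < 0) :
    ∀ᶠ t in 𝓝[>] x, f t ≤ 0 := by
  rcases h0.lt_or_eq with h | h
  · have := hf.continuousWithinAt.mono Ioi_subset_Ici_self
    filter_upwards [this.eventually (gt_mem_nhds h)] with t ht using ht.le
  · have h1 := (hasDerivWithinAt_iff_tendsto_slope' (by simp)).1 (hf.mono Ioi_subset_Ici_self)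
    filter_upwards [h1.eventually (gt_mem_nhds (hneg h)), self_mem_nhdsWithin] with t ht htx
    rw [slope_def_field, h, sub_zero, div_lt_iff₀ (sub_pos.2 htx), zero_mul] at ht
    exact ht.le

/-- A scalar periodic equation on the strip `m ≤ ρ ≤ M` with two barriers, the first keeping
solutions below `M` and the second keeping them above `m`, has a periodic solution. -/
theorem exists_periodic_solution_of_barriers {R : ℝ → ℝ → ℝ} {T m M : ℝ} (hT : 0 < T)
    (hmM : m ≤ M) (hR : ∀ t, ∀ ρ ∈ Icc m M, ContDiffAt ℝ 1 (Function.uncurry R) (t, ρ))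
    (hper : ∀ t x, R (t + T) x = R t x) {v w : ℝ × ℝ → ℝ} (hv : Differentiable ℝ v)
    (hw : Differentiable ℝ w) (hvper : ∀ t x, v (t + T, x) = v (t, x))
    (hwper : ∀ t x, w (t + T, x) = w (t, x))
    (hvM : ∀ t, 0 < v (t, M)) (hwm : ∀ t, 0 < w (t, m))
    (hvneg : ∀ t, ∀ ρ ∈ Icc m M, v (t, ρ) = 0 → fderiv ℝ v (t, ρ) (1, R t ρ) < 0)
    (hwneg : ∀ t, ∀ ρ ∈ Icc m M, w (t, ρ) = 0 → fderiv ℝ w (t, ρ) (1, R t ρ) < 0)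
    {ρ₀ : ℝ} (hρ₀ : ρ₀ ∈ Icc m M) (hv₀ : v (0, ρ₀) ≤ 0) (hw₀ : w (0, ρ₀) ≤ 0) :
    ∃ q : ℝ → ℝ, Function.Periodic q T ∧ (∀ t, q t ∈ Icc m M) ∧
      ∀ t, HasDerivAt q (R t (q t)) t := by
  -- Clamping the radius to the strip makes the field globally Lipschitz and bounded; the periodic
  -- solution found never leaves the strip, so it solves the original equation.
  set Rc : ℝ → ℝ → ℝ := fun t x => R t (projIcc m M hmM x) with hRc
  have hperc : ∀ t x, Rc (t + T) x = Rc t x := fun t x => hper _ _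
  have hmod : ∀ t, ∃ s ∈ Icc 0 T, Rc t = Rc s := by
    intro t
    have hp : Function.Periodic Rc T := fun t => funext fun x => hperc t x
    obtain ⟨s, hs, e⟩ := hp.exists_mem_Ico₀ hT t
    exact ⟨s, ⟨hs.1, hs.2.le⟩, e⟩
  have hc : Continuous (Function.uncurry Rc) := by
    rw [continuous_iff_continuousAt]
    rintro ⟨t, x⟩
    have h1 : Continuous fun z : ℝ × ℝ => (z.1, (projIcc m M hmM z.2 : ℝ)) := by fun_prop
    exact ContinuousAt.comp (f := fun z : ℝ × ℝ => (z.1, (projIcc m M hmM z.2 : ℝ)))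
      (g := Function.uncurry R) (hR t _ (projIcc m M hmM x).2).continuousAt h1.continuousAt
  have hcomp : IsCompact (Icc 0 T ×ˢ Icc m M) := isCompact_Icc.prod isCompact_Icc
  obtain ⟨K, hK⟩ : ∃ K, LipschitzOnWith K (Function.uncurry R) (Icc 0 T ×ˢ Icc m M) := by
    refine LocallyLipschitzOn.exists_lipschitzOnWith_of_compact hcomp ?_
    rintro ⟨t, ρ⟩ hz
    obtain ⟨K, s, hs, h⟩ := (hR t ρ hz.2).exists_lipschitzOnWith
    exact ⟨K, s, mem_nhdsWithin_of_mem_nhds hs, h⟩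
  have hKc : ∀ t, LipschitzWith K (Rc t) := by
    intro t
    obtain ⟨s, hs, e⟩ := hmod t
    rw [e]
    refine LipschitzWith.of_dist_le_mul fun x y => ?_
    have h1 := hK.dist_le_mul (s, (projIcc m M hmM x : ℝ)) ⟨hs, (projIcc m M hmM x).2⟩
      (s, (projIcc m M hmM y : ℝ)) ⟨hs, (projIcc m M hmM y).2⟩
    refine h1.trans (mul_le_mul_of_nonneg_left ?_ K.2)
    have h2 := (LipschitzWith.projIcc hmM).dist_le_mul x y
    rw [Prod.dist_eq, dist_self, max_eq_right dist_nonneg]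
    simpa [Subtype.dist_eq] using h2
  obtain ⟨B, hB⟩ : ∃ B, ∀ z ∈ Icc 0 T ×ˢ Icc m M, ‖Function.uncurry R z‖ ≤ B :=
    hcomp.exists_bound_of_continuousOn fun z hz => (hR z.1 z.2 hz.2).continuousAt.continuousWithinAt
  have hBc : ∀ t x, |Rc t x| ≤ B := by
    intro t x
    obtain ⟨s, hs, e⟩ := hmod t
    rw [e]
    exact hB (s, (projIcc m M hmM x : ℝ)) ⟨hs, (projIcc m M hmM x).2⟩
  have hvline : Continuous fun x : ℝ => v (0, x) := hv.continuous.comp (by fun_prop)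
  have hwline : Continuous fun x : ℝ => w (0, x) := hw.continuous.comp (by fun_prop)
  set A : Set ℝ := Icc m M ∩ ({x | v (0, x) ≤ 0} ∩ {x | w (0, x) ≤ 0}) with hA
  have hAc : IsCompact A := isCompact_Icc.inter_right
    ((isClosed_le hvline continuous_const).inter (isClosed_le hwline continuous_const))
  obtain ⟨q, hqp, hqm, hqd⟩ := exists_periodic_solution (m := m) (M := M) hT hc hKc hBc hperc hAc
    ⟨ρ₀, hρ₀, hv₀, hw₀⟩ (by
      intro α hα hα0
      have hαc : ContinuousOn α (Icc 0 T) := fun t ht => (hα t ht).continuousWithinAt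
      have hgc : ContinuousOn (fun t => (t, α t)) (Icc 0 T) := continuousOn_id.prodMk hαc
      have hcv : ContinuousOn (fun t => v (t, α t)) (Icc 0 T) := hv.continuous.comp_continuousOn hgc
      have hcw : ContinuousOn (fun t => w (t, α t)) (Icc 0 T) := hw.continuous.comp_continuousOn hgc
      set S : Set ℝ := {t | α t ∈ Icc m M ∧ v (t, α t) ≤ 0 ∧ w (t, α t) ≤ 0} with hS
      have hsub : Icc 0 T ⊆ S := by
        -- Continuous induction: the barrier conditions are closed and persist a little to the
        -- right, since a barrier at value zero is strictly decreasing. Positivity on the edges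
        -- keeps the solution strictly inside the strip.
        refine IsClosed.Icc_subset_of_forall_exists_gt ?_ ⟨hα0.1, hα0.2⟩ ?_
        · have h1 := hαc.preimage_isClosed_of_isClosed isClosed_Icc (isClosed_Icc (a := m) (b := M))
          have h2 := hcv.preimage_isClosed_of_isClosed isClosed_Icc (isClosed_Iic (a := (0 : ℝ)))
          have h3 := hcw.preimage_isClosed_of_isClosed isClosed_Icc (isClosed_Iic (a := (0 : ℝ)))
          convert h1.inter (h2.inter h3) using 1
          ext t
          simp only [hS, mem_inter_iff, mem_ofPred_eq, mem_preimage, mem_Iic]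
          tauto
        · rintro x ⟨⟨hx1, hx2, hx3⟩, hx⟩ y hy
          have hxI : x ∈ Icc 0 T := ⟨hx.1, hx.2.le⟩
          have hmem : Icc 0 T ∈ 𝓝[Ici x] x :=
            mem_of_superset (Icc_mem_nhdsGE hx.2) (Icc_subset_Icc_left hx.1)
          have hd : HasDerivWithinAt α (R x (α x)) (Ici x) x := by
            have := (hα x hxI).mono_of_mem_nhdsWithin hmem
            simpa only [hRc, projIcc_of_mem hmM hx1] using this
          have hgd : HasDerivWithinAt (fun t => (t, α t)) (1, R x (α x)) (Ici x) x :=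
            (hasDerivWithinAt_id x _).prodMk hd
          have hvd : HasDerivWithinAt (fun t => v (t, α t))
              (fderiv ℝ v (x, α x) (1, R x (α x))) (Ici x) x :=
            (hv (x, α x)).hasFDerivAt.comp_hasDerivWithinAt x hgd
          have hwd : HasDerivWithinAt (fun t => w (t, α t))
              (fderiv ℝ w (x, α x) (1, R x (α x))) (Ici x) x :=
            (hw (x, α x)).hasFDerivAt.comp_hasDerivWithinAt x hgd
          have hltM : α x < M := lt_of_le_of_ne hx1.2 fun h => by
            rw [h] at hx2; exact absurd (hvM x) (not_lt.2 hx2)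
          have hltm : m < α x := lt_of_le_of_ne hx1.1 fun h => by
            rw [← h] at hx3; exact absurd (hwm x) (not_lt.2 hx3)
          have hcx : Tendsto α (𝓝[>] x) (𝓝 (α x)) :=
            (hd.mono Ioi_subset_Ici_self).continuousWithinAt
          have hev : ∀ᶠ t in 𝓝[>] x, t ∈ S ∩ Ioc x y := by
            filter_upwards [eventually_nonpos_of_hasDerivWithinAt hvd hx2 (hvneg x _ hx1),
              eventually_nonpos_of_hasDerivWithinAt hwd hx3 (hwneg x _ hx1),
              hcx.eventually (Icc_mem_nhds hltm hltM), Ioc_mem_nhdsGT hy] with t h1 h2 h3 h4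
            exact ⟨⟨h3, h1, h2⟩, h4⟩
          exact hev.exists
      have hTT := hsub (right_mem_Icc.2 hT.le)
      have e1 := hvper 0 (α T)
      have e2 := hwper 0 (α T)
      rw [zero_add] at e1 e2
      exact ⟨fun t ht => (hsub ht).1, hTT.1, e1.symm.le.trans hTT.2.1, e2.symm.le.trans hTT.2.2⟩)
  refine ⟨q, hqp, hqm, fun t => ?_⟩
  have := hqd t
  simpa only [hRc, projIcc_of_mem hmM (hqm t)] using this

/-! ### Cycles of rotating planar fields -/

/-- The point with polar coordinates `ρ`, `θ` around `c`. -/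
noncomputable def polarPoint (c : ℝ × ℝ) (ρ θ : ℝ) : ℝ × ℝ :=
  (c.1 + ρ * Real.cos θ, c.2 + ρ * Real.sin θ)

theorem contDiff_polarPoint (c : ℝ × ℝ) :
    ContDiff ℝ 1 fun z : ℝ × ℝ => polarPoint c z.2 z.1 := by
  unfold polarPoint
  fun_prop

theorem polarPoint_add_two_pi (c : ℝ × ℝ) (ρ θ : ℝ) :
    polarPoint c ρ (θ + 2 * Real.pi) = polarPoint c ρ θ := by
  simp [polarPoint]

theorem hasDerivAt_polarPoint (c : ℝ × ℝ) {q φ : ℝ → ℝ} {q' φ' t : ℝ} (hq : HasDerivAt q q' t)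
    (hφ : HasDerivAt φ φ' t) :
    HasDerivAt (fun s => polarPoint c (q s) (φ s))
      (q' * Real.cos (φ t) - q t * Real.sin (φ t) * φ',
        q' * Real.sin (φ t) + q t * Real.cos (φ t) * φ') t := by
  unfold polarPoint
  have h1 := (hq.mul hφ.cos).const_add c.1
  have h2 := (hq.mul hφ.sin).const_add c.2
  refine (h1.prodMk h2).congr_deriv ?_
  ext <;> simp <;> ring

/-- A planar field which rotates in an annulus, with two barriers keeping its trajectories away
from the two boundary circles, has a cycle in the annulus. -/
theorem exists_cycle_of_barriers {Y : ℝ × ℝ → ℝ × ℝ} {c : ℝ × ℝ} {m M : ℝ} (hm : 0 < m)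
    (hmM : m ≤ M) (hY : ∀ ρ ∈ Icc m M, ∀ θ, ContDiffAt ℝ 1 Y (polarPoint c ρ θ))
    (hrot : ∀ ρ ∈ Icc m M, ∀ θ,
      0 < Real.cos θ * (Y (polarPoint c ρ θ)).2 - Real.sin θ * (Y (polarPoint c ρ θ)).1)
    {V W : ℝ × ℝ → ℝ} (hV : Differentiable ℝ V) (hW : Differentiable ℝ W)
    (hVM : ∀ θ, 0 < V (polarPoint c M θ)) (hWm : ∀ θ, 0 < W (polarPoint c m θ))
    (hVneg : ∀ ρ ∈ Icc m M, ∀ θ, V (polarPoint c ρ θ) = 0 →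
      fderiv ℝ V (polarPoint c ρ θ) (Y (polarPoint c ρ θ)) < 0)
    (hWneg : ∀ ρ ∈ Icc m M, ∀ θ, W (polarPoint c ρ θ) = 0 →
      fderiv ℝ W (polarPoint c ρ θ) (Y (polarPoint c ρ θ)) < 0)
    {ρ₀ : ℝ} (hρ₀ : ρ₀ ∈ Icc m M) (hV₀ : V (polarPoint c ρ₀ 0) ≤ 0)
    (hW₀ : W (polarPoint c ρ₀ 0) ≤ 0) :
    ∃ C, IsCycle Y C ∧ ∀ p ∈ C, ∃ ρ ∈ Icc m M, ∃ θ, p = polarPoint c ρ θ := by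
  set P : ℝ → ℝ → ℝ × ℝ := polarPoint c with hP
  set S : ℝ → ℝ → ℝ := fun θ ρ => Real.cos θ * (Y (P ρ θ)).2 - Real.sin θ * (Y (P ρ θ)).1 with hS
  set N : ℝ → ℝ → ℝ := fun θ ρ => Real.cos θ * (Y (P ρ θ)).1 + Real.sin θ * (Y (P ρ θ)).2 with hN
  -- Along the field ρ' = N and θ' = S/ρ, hence dρ/dθ = ρN/S.
  set R : ℝ → ℝ → ℝ := fun θ ρ => ρ * N θ ρ / S θ ρ with hRdef
  have hSpos : ∀ θ, ∀ ρ ∈ Icc m M, 0 < S θ ρ := fun θ ρ hρ => hrot ρ hρ θ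
  have hYP : ∀ θ, ∀ ρ ∈ Icc m M, ContDiffAt ℝ 1 (fun z : ℝ × ℝ => Y (P z.2 z.1)) (θ, ρ) :=
    fun θ ρ hρ => ContDiffAt.comp (g := Y) (f := fun z : ℝ × ℝ => P z.2 z.1) (θ, ρ)
      (hY ρ hρ θ) (contDiff_polarPoint c).contDiffAt
  have hSd : ∀ θ, ∀ ρ ∈ Icc m M, ContDiffAt ℝ 1 (Function.uncurry S) (θ, ρ) := by
    intro θ ρ hρ
    have h := hYP θ ρ hρ
    have h1 : ContDiffAt ℝ 1 (fun z : ℝ × ℝ => (Y (P z.2 z.1)).1) (θ, ρ) := h.fst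
    have h2 : ContDiffAt ℝ 1 (fun z : ℝ × ℝ => (Y (P z.2 z.1)).2) (θ, ρ) := h.snd
    have h3 : ContDiffAt ℝ 1 (fun z : ℝ × ℝ => Real.cos z.1) (θ, ρ) := by fun_prop
    have h4 : ContDiffAt ℝ 1 (fun z : ℝ × ℝ => Real.sin z.1) (θ, ρ) := by fun_prop
    exact (h3.mul h2).sub (h4.mul h1)
  have hR : ∀ θ, ∀ ρ ∈ Icc m M, ContDiffAt ℝ 1 (Function.uncurry R) (θ, ρ) := by
    intro θ ρ hρ
    have h := hYP θ ρ hρ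
    have h1 : ContDiffAt ℝ 1 (fun z : ℝ × ℝ => (Y (P z.2 z.1)).1) (θ, ρ) := h.fst
    have h2 : ContDiffAt ℝ 1 (fun z : ℝ × ℝ => (Y (P z.2 z.1)).2) (θ, ρ) := h.snd
    have h3 : ContDiffAt ℝ 1 (fun z : ℝ × ℝ => Real.cos z.1) (θ, ρ) := by fun_prop
    have h4 : ContDiffAt ℝ 1 (fun z : ℝ × ℝ => Real.sin z.1) (θ, ρ) := by fun_prop
    exact (contDiffAt_snd.mul ((h3.mul h1).add (h4.mul h2))).div (hSd θ ρ hρ) (hSpos θ ρ hρ).ne'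
  have hPper : ∀ ρ θ, P ρ (θ + 2 * Real.pi) = P ρ θ := polarPoint_add_two_pi c
  have hSper : ∀ θ ρ, S (θ + 2 * Real.pi) ρ = S θ ρ := fun θ ρ => by
    simp only [hS, hPper, Real.cos_add_two_pi, Real.sin_add_two_pi]
  have hRper : ∀ θ ρ, R (θ + 2 * Real.pi) ρ = R θ ρ := fun θ ρ => by
    simp only [hRdef, hN, hSper, hPper, Real.cos_add_two_pi, Real.sin_add_two_pi]
  have hPd : Differentiable ℝ fun z : ℝ × ℝ => P z.2 z.1 :=
    (contDiff_polarPoint c).differentiable one_ne_zero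
  have hsc : ∀ θ, Real.sin θ ^ 2 + Real.cos θ ^ 2 = 1 := Real.sin_sq_add_cos_sq
  have htan : ∀ θ, ∀ ρ ∈ Icc m M,
      (R θ ρ * Real.cos θ - ρ * Real.sin θ, R θ ρ * Real.sin θ + ρ * Real.cos θ)
        = (ρ / S θ ρ) • Y (P ρ θ) := by
    intro θ ρ hρ
    have h0 := (hSpos θ ρ hρ).ne'
    ext
    · simp only [hRdef, Prod.smul_fst, smul_eq_mul]
      field_simp
      simp only [hN, hS]
      linear_combination ρ * (Y (P ρ θ)).1 * hsc θ
    · simp only [hRdef, Prod.smul_snd, smul_eq_mul]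
      field_simp
      simp only [hN, hS]
      linear_combination ρ * (Y (P ρ θ)).2 * hsc θ
  -- By `htan`, motion along the scalar equation is the field times ρ/S > 0, so the sign of a
  -- barrier's derivative is the same in both pictures.
  have hneg : ∀ {Z : ℝ × ℝ → ℝ}, Differentiable ℝ Z →
      (∀ ρ ∈ Icc m M, ∀ θ, Z (P ρ θ) = 0 → fderiv ℝ Z (P ρ θ) (Y (P ρ θ)) < 0) →
      ∀ θ, ∀ ρ ∈ Icc m M, Z (P ρ θ) = 0 →
        fderiv ℝ (fun z : ℝ × ℝ => Z (P z.2 z.1)) (θ, ρ) (1, R θ ρ) < 0 := by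
    intro Z hZ h θ ρ hρ h0
    have hline : HasDerivAt (fun s => ((θ + s, ρ + s * R θ ρ) : ℝ × ℝ)) (1, R θ ρ) 0 := by
      have h1 := (hasDerivAt_id (0 : ℝ)).const_add θ
      have h2 := ((hasDerivAt_id (0 : ℝ)).mul_const (R θ ρ)).const_add ρ
      rw [one_mul] at h2
      exact h1.prodMk h2
    have hP1 : HasDerivAt (fun s => P (ρ + s * R θ ρ) (θ + s))
        ((ρ / S θ ρ) • Y (P ρ θ)) 0 := by
      rw [← htan θ ρ hρ]
      have h1 := (hasDerivAt_id (0 : ℝ)).const_add θ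
      have h2 := ((hasDerivAt_id (0 : ℝ)).mul_const (R θ ρ)).const_add ρ
      have h3 := hasDerivAt_polarPoint c h2 h1
      simpa using h3
    have hA : HasDerivAt (fun s => Z (P (ρ + s * R θ ρ) (θ + s)))
        (fderiv ℝ Z (P ρ θ) ((ρ / S θ ρ) • Y (P ρ θ))) 0 := by
      have h1 : HasFDerivAt Z (fderiv ℝ Z (P ρ θ)) (P (ρ + 0 * R θ ρ) (θ + 0)) := by
        rw [zero_mul, add_zero, add_zero]; exact (hZ _).hasFDerivAt
      exact h1.comp_hasDerivAt (0 : ℝ) hP1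
    have hB : HasDerivAt (fun s => Z (P (ρ + s * R θ ρ) (θ + s)))
        (fderiv ℝ (fun z : ℝ × ℝ => Z (P z.2 z.1)) (θ, ρ) (1, R θ ρ)) 0 := by
      have h1 : HasFDerivAt (fun z : ℝ × ℝ => Z (P z.2 z.1))
          (fderiv ℝ (fun z : ℝ × ℝ => Z (P z.2 z.1)) (θ, ρ)) (θ + 0, ρ + 0 * R θ ρ) := by
        rw [zero_mul, add_zero, add_zero]; exact ((hZ.comp hPd) _).hasFDerivAt
      exact HasFDerivAt.comp_hasDerivAt (l := fun z : ℝ × ℝ => Z (P z.2 z.1))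
        (f := fun s => ((θ + s, ρ + s * R θ ρ) : ℝ × ℝ)) (0 : ℝ) h1 hline
    rw [hB.unique hA, map_smul, smul_eq_mul]
    exact mul_neg_of_pos_of_neg (div_pos (hm.trans_le hρ.1) (hSpos θ ρ hρ)) (h ρ hρ θ h0)
  obtain ⟨q, hqp, hqm, hqd⟩ := exists_periodic_solution_of_barriers
    (v := fun z => V (P z.2 z.1)) (w := fun z => W (P z.2 z.1)) Real.two_pi_pos hmM hR hRper
    (hV.comp hPd) (hW.comp hPd) (fun θ ρ => by simp only [hPper])
    (fun θ ρ => by simp only [hPper]) hVM hWm (hneg hV hVneg) (hneg hW hWneg) hρ₀ hV₀ hW₀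
  have hqc : Continuous q := continuous_iff_continuousAt.2 fun t => (hqd t).continuousAt
  -- The angular speed on the closed curve ρ = q(θ) recovers the time parametrization.
  obtain ⟨φ, T, hT, hφ, hφT⟩ := exists_angle_solution (k := fun θ => S θ (q θ) / q θ)
    Real.two_pi_pos (by
      refine Continuous.div ?_ hqc fun θ => (hm.trans_le (hqm θ).1).ne'
      rw [continuous_iff_continuousAt]
      intro θ
      exact ContinuousAt.comp (g := Function.uncurry S) (f := fun θ => (θ, q θ))
        (hSd θ (q θ) (hqm θ)).continuousAt (by fun_prop))
    (fun θ => div_pos (hSpos θ _ (hqm θ)) (hm.trans_le (hqm θ).1))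
    (fun θ => by simp only [hqp θ, hSper])
  set γ : ℝ → ℝ × ℝ := fun t => P (q (φ t)) (φ t) with hγ
  have hγd : ∀ t, HasDerivAt γ (Y (γ t)) t := by
    intro t
    have h1 := hasDerivAt_polarPoint c ((hqd (φ t)).comp t (hφ t)) (hφ t)
    refine h1.congr_deriv ?_
    have h2 := htan (φ t) _ (hqm (φ t))
    have h3 : γ t = P (q (φ t)) (φ t) := rfl
    have h4 : 0 < S (φ t) (q (φ t)) := hSpos _ _ (hqm _)
    have h5 : 0 < q (φ t) := hm.trans_le (hqm (φ t)).1
    have h6 : Y (γ t) = (S (φ t) (q (φ t)) / q (φ t)) •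
        ((q (φ t) / S (φ t) (q (φ t))) • Y (P (q (φ t)) (φ t))) := by
      rw [smul_smul, h3, div_mul_div_cancel₀ h5.ne', div_self h4.ne', one_smul]
    rw [h6, ← h2]
    ext <;> simp <;> ring
  refine ⟨range γ, ⟨γ, T, hT, hγd, fun t => ?_, ?_, rfl⟩, ?_⟩
  · simp only [hγ, hφT, hqp (φ t), hPper]
  · by_contra! hconst
    have h1 : γ = fun _ => γ 0 := funext hconst
    have h2 : HasDerivAt γ 0 0 := by rw [h1]; exact hasDerivAt_const _ _
    have h3 : Y (γ 0) = 0 := (hγd 0).unique h2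
    have h4 := hSpos (φ 0) _ (hqm (φ 0))
    have h5 : Y (P (q (φ 0)) (φ 0)) = 0 := h3
    simp [hS, h5] at h4
  · rintro _ ⟨t, rfl⟩
    exact ⟨_, hqm (φ t), _, rfl⟩

/-! ### The repelling weak focus at ε = 0 -/

/-- A Lyapunov function up to fourth order for the weak focus `u' = y`,
`y' = -(a u + b u²) y - (w u + c u² + d u³)`, where `l = a c / w - b`. -/
noncomputable def focusLyapunov (a w c d l : ℝ) (p : ℝ × ℝ) : ℝ :=
  (p.2 ^ 2 + w * p.1 ^ 2) / 2 + c * p.1 ^ 3 / 3 - a * p.2 ^ 3 / (3 * w) + d * p.1 ^ 4 / 4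
    + a ^ 2 * p.2 ^ 4 / (4 * w ^ 2) - l * p.1 ^ 3 * p.2 / 8 + l * p.1 * p.2 ^ 3 / (8 * w)

/-- The partial derivative of `focusLyapunov` in the first variable. -/
noncomputable def focusLyapunovFst (w c d l : ℝ) (p : ℝ × ℝ) : ℝ :=
  w * p.1 + c * p.1 ^ 2 + d * p.1 ^ 3 - 3 * l * p.1 ^ 2 * p.2 / 8 + l * p.2 ^ 3 / (8 * w)

/-- The partial derivative of `focusLyapunov` in the second variable. -/
noncomputable def focusLyapunovSnd (a w l : ℝ) (p : ℝ × ℝ) : ℝ :=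
  p.2 - a * p.2 ^ 2 / w + a ^ 2 * p.2 ^ 3 / w ^ 2 - l * p.1 ^ 3 / 8 + 3 * l * p.1 * p.2 ^ 2 / (8 * w)

theorem differentiable_focusLyapunov (a w c d l : ℝ) :
    Differentiable ℝ (focusLyapunov a w c d l) := by
  unfold focusLyapunov; fun_prop

theorem continuous_focusLyapunovFst (w c d l : ℝ) : Continuous (focusLyapunovFst w c d l) := by
  unfold focusLyapunovFst; fun_prop

theorem continuous_focusLyapunovSnd (a w l : ℝ) : Continuous (focusLyapunovSnd a w l) := by
  unfold focusLyapunovSnd; fun_prop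

theorem fderiv_focusLyapunov {w : ℝ} (hw : w ≠ 0) (a c d l : ℝ) (p z : ℝ × ℝ) :
    fderiv ℝ (focusLyapunov a w c d l) p z
      = focusLyapunovFst w c d l p * z.1 + focusLyapunovSnd a w l p * z.2 := by
  have h1 : HasDerivAt (fun s : ℝ => p + s • z) z 0 := by
    simpa using ((hasDerivAt_id (0 : ℝ)).smul_const z).const_add p
  have hA : HasDerivAt (fun s : ℝ => focusLyapunov a w c d l (p + s • z))
      (fderiv ℝ (focusLyapunov a w c d l) p z) 0 := by
    have h2 : HasFDerivAt (focusLyapunov a w c d l) (fderiv ℝ (focusLyapunov a w c d l) p)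
        (p + (0 : ℝ) • z) := by
      rw [zero_smul, add_zero]; exact (differentiable_focusLyapunov a w c d l p).hasFDerivAt
    exact h2.comp_hasDerivAt (0 : ℝ) h1
  refine hA.unique ?_
  have hu : HasDerivAt (fun s : ℝ => p.1 + s * z.1) z.1 0 := by
    simpa using ((hasDerivAt_id (0 : ℝ)).mul_const z.1).const_add p.1
  have hy : HasDerivAt (fun s : ℝ => p.2 + s * z.2) z.2 0 := by
    simpa using ((hasDerivAt_id (0 : ℝ)).mul_const z.2).const_add p.2
  have key := (((((((hy.pow 2).add ((hu.pow 2).const_mul w)).div_const 2).add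
    (((hu.pow 3).const_mul c).div_const 3)).sub (((hy.pow 3).const_mul a).div_const (3 * w))).add
    (((hu.pow 4).const_mul d).div_const 4)).add
    (((hy.pow 4).const_mul (a ^ 2)).div_const (4 * w ^ 2))).sub
    ((((hu.pow 3).const_mul l).mul hy).div_const 8) |>.add
    (((hu.const_mul l).mul (hy.pow 3)).div_const (8 * w))
  refine key.congr_deriv ?_
  simp only [focusLyapunovFst, focusLyapunovSnd]
  norm_num
  field_simp
  ring

theorem isBigO_fst_norm : (fun p : ℝ × ℝ => p.1) =O[𝓝 0] fun p => ‖p‖ :=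
  IsBigO.of_norm_le fun p => norm_fst_le p

theorem isBigO_snd_norm : (fun p : ℝ × ℝ => p.2) =O[𝓝 0] fun p => ‖p‖ :=
  IsBigO.of_norm_le fun p => norm_snd_le p

theorem isLittleO_norm_pow {m n : ℕ} (h : m < n) :
    (fun p : ℝ × ℝ => ‖p‖ ^ n) =o[𝓝 0] fun p => ‖p‖ ^ m :=
  (isLittleO_pow_pow h).comp_tendsto tendsto_norm_zero

theorem isBigO_monomial (C : ℝ) (i j : ℕ) :
    (fun p : ℝ × ℝ => C * (p.1 ^ i * p.2 ^ j)) =O[𝓝 0] fun p => ‖p‖ ^ (i + j) := by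
  have := ((isBigO_fst_norm.pow i).mul (isBigO_snd_norm.pow j)).const_mul_left C
  simpa only [← pow_add] using this

/-- The sup norm is |u| or |y|, so the quadratic part is at least min(1, w)/2 times its square; half
of this absorbs the terms of degree three and four. -/
theorem eventually_mul_norm_sq_le_focusLyapunov {w : ℝ} (hw : 0 < w) (a c d l : ℝ) :
    ∀ᶠ p in 𝓝 (0 : ℝ × ℝ), min 1 w / 4 * ‖p‖ ^ 2 ≤ focusLyapunov a w c d l p := by
  have hrem : (fun p : ℝ × ℝ => focusLyapunov a w c d l p - (p.2 ^ 2 + w * p.1 ^ 2) / 2)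
      =o[𝓝 0] fun p => ‖p‖ ^ 2 := by
    have h3 : ∀ (C : ℝ) (i j : ℕ), 2 < i + j →
        (fun p : ℝ × ℝ => C * (p.1 ^ i * p.2 ^ j)) =o[𝓝 0] fun p => ‖p‖ ^ 2 :=
      fun C i j h => (isBigO_monomial C i j).trans_isLittleO (isLittleO_norm_pow h)
    have := (((((h3 (c / 3) 3 0 (by norm_num)).add (h3 (-a / (3 * w)) 0 3 (by norm_num))).add
      (h3 (d / 4) 4 0 (by norm_num))).add (h3 (a ^ 2 / (4 * w ^ 2)) 0 4 (by norm_num))).add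
      (h3 (-l / 8) 3 1 (by norm_num))).add (h3 (l / (8 * w)) 1 3 (by norm_num))
    refine this.congr_left fun p => ?_
    simp only [focusLyapunov]
    ring
  have hmin : 0 < min 1 w := lt_min one_pos hw
  filter_upwards [hrem.bound (show 0 < min 1 w / 4 by positivity)] with p hp
  have h1 := (abs_le.1 (Real.norm_eq_abs _ ▸ hp)).1
  have h2 : min 1 w * ‖p‖ ^ 2 ≤ p.2 ^ 2 + w * p.1 ^ 2 := by
    rcases max_choice ‖p.1‖ ‖p.2‖ with h | h <;> rw [Prod.norm_def, h, Real.norm_eq_abs, sq_abs]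
    · have := mul_le_mul_of_nonneg_right (min_le_right 1 w) (sq_nonneg p.1)
      nlinarith [sq_nonneg p.2]
    · have := mul_le_mul_of_nonneg_right (min_le_left 1 w) (sq_nonneg p.2)
      nlinarith [mul_nonneg hw.le (sq_nonneg p.1)]
  rw [norm_pow, norm_norm] at h1
  linarith

/-- The derivative of `focusLyapunov` along the field is positive near a repelling weak focus. -/
theorem eventually_focusLyapunov_deriv_pos {a b w c d l : ℝ} (hw : 0 < w) (hl : 0 < l)
    (hlb : l * w = a * c - b * w) {f g : ℝ → ℝ}
    (hf : (fun u => f u - (a * u + b * u ^ 2)) =o[𝓝 0] fun u => u ^ 2)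
    (hg : (fun u => g u - (w * u + c * u ^ 2 + d * u ^ 3)) =o[𝓝 0] fun u => u ^ 3) :
    ∀ᶠ p in 𝓝 (0 : ℝ × ℝ), p ≠ 0 →
      0 < focusLyapunovFst w c d l p * p.2
        + focusLyapunovSnd a w l p * (-f p.1 * p.2 - g p.1) := by
  have hfst : Tendsto (fun p : ℝ × ℝ => p.1) (𝓝 0) (𝓝 0) := continuous_fst.tendsto' _ _ rfl
  have hrf : (fun p : ℝ × ℝ => f p.1 - (a * p.1 + b * p.1 ^ 2)) =o[𝓝 0] fun p => ‖p‖ ^ 2 :=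
    (hf.comp_tendsto hfst).trans_isBigO (isBigO_fst_norm.pow 2)
  have hrg : (fun p : ℝ × ℝ => g p.1 - (w * p.1 + c * p.1 ^ 2 + d * p.1 ^ 3)) =o[𝓝 0]
      fun p => ‖p‖ ^ 3 :=
    (hg.comp_tendsto hfst).trans_isBigO (isBigO_fst_norm.pow 3)
  set A2 : ℝ × ℝ → ℝ := fun p => a * (p.1 ^ 1 * p.2 ^ 1) + c * (p.1 ^ 2 * p.2 ^ 0) with hA2
  set A3 : ℝ × ℝ → ℝ := fun p => b * (p.1 ^ 2 * p.2 ^ 1) + d * (p.1 ^ 3 * p.2 ^ 0) with hA3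
  set S2 : ℝ × ℝ → ℝ := fun p => (-a / w) * (p.1 ^ 0 * p.2 ^ 2) with hS2
  set S3 : ℝ × ℝ → ℝ := fun p => (a ^ 2 / w ^ 2) * (p.1 ^ 0 * p.2 ^ 3)
    + (-l / 8) * (p.1 ^ 3 * p.2 ^ 0) + (3 * l / (8 * w)) * (p.1 ^ 1 * p.2 ^ 2) with hS3
  have oA2 : A2 =O[𝓝 0] fun p => ‖p‖ ^ 2 := (isBigO_monomial a 1 1).add (isBigO_monomial c 2 0)
  have oA3 : A3 =O[𝓝 0] fun p => ‖p‖ ^ 3 := (isBigO_monomial b 2 1).add (isBigO_monomial d 3 0)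
  have oS2 : S2 =O[𝓝 0] fun p => ‖p‖ ^ 2 := isBigO_monomial _ 0 2
  have oS3 : S3 =O[𝓝 0] fun p => ‖p‖ ^ 3 := ((isBigO_monomial _ 0 3).add
    (isBigO_monomial _ 3 0)).add (isBigO_monomial _ 1 2)
  have hpow : ∀ {m n : ℕ} {φ ψ : ℝ × ℝ → ℝ}, (φ =O[𝓝 0] fun p => ‖p‖ ^ m) →
      (ψ =O[𝓝 0] fun p => ‖p‖ ^ n) → 4 < m + n →
      (fun p => φ p * ψ p) =o[𝓝 0] fun p => ‖p‖ ^ 4 := by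
    intro m n φ ψ h1 h2 h
    have := h1.mul h2
    simp only [← pow_add] at this
    exact this.trans_isLittleO (isLittleO_norm_pow h)
  have oS : (focusLyapunovSnd a w l) =O[𝓝 0] fun p => ‖p‖ := by
    have h1 : ∀ {φ : ℝ × ℝ → ℝ} {n : ℕ}, 1 < n → (φ =O[𝓝 0] fun p => ‖p‖ ^ n) →
        φ =O[𝓝 0] fun p => ‖p‖ := fun hn h => by
      simpa only [pow_one] using h.trans (isLittleO_norm_pow hn).isBigO
    refine ((isBigO_snd_norm.add (h1 (by norm_num) oS2)).add
      (h1 (by norm_num) oS3)).congr_left fun p => ?_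
    simp only [hS2, hS3, focusLyapunovSnd]
    ring
  have oR : (fun p : ℝ × ℝ => (f p.1 - (a * p.1 + b * p.1 ^ 2)) * p.2
      + (g p.1 - (w * p.1 + c * p.1 ^ 2 + d * p.1 ^ 3))) =o[𝓝 0] fun p => ‖p‖ ^ 3 := by
    refine IsLittleO.add ?_ hrg
    refine (hrf.mul_isBigO isBigO_snd_norm).congr_right fun p => by ring
  have oSR := oS.mul_isLittleO oR
  have hrem := ((((hpow oS2 oA3 (by norm_num)).add (hpow oS3 oA2 (by norm_num))).add
    (hpow oS3 oA3 (by norm_num))).add (oSR.congr_right (g₂ := fun p : ℝ × ℝ => ‖p‖ ^ 4)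
      fun p => by ring))
  have hk : 0 < l * min w w⁻¹ / 16 := by
    have : 0 < min w w⁻¹ := lt_min hw (inv_pos.2 hw)
    positivity
  filter_upwards [hrem.bound hk] with p hp hp0
  have hp1 := (abs_le.1 (Real.norm_eq_abs _ ▸ hp)).2
  rw [norm_pow, norm_norm] at hp1
  have hquart : l * min w w⁻¹ / 8 * ‖p‖ ^ 4
      ≤ l / 4 * (p.1 ^ 2 * p.2 ^ 2) + w * l / 8 * p.1 ^ 4 + l * w⁻¹ / 8 * p.2 ^ 4 := by
    have e1 : 0 ≤ l / 4 * (p.1 ^ 2 * p.2 ^ 2) := by positivity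
    have e2 : 0 ≤ w * l / 8 * p.1 ^ 4 := by positivity
    have e3 : 0 ≤ l * w⁻¹ / 8 * p.2 ^ 4 := by positivity
    have habs : ∀ x : ℝ, |x| ^ 4 = x ^ 4 := fun x => Even.pow_abs (by decide) x
    rcases max_choice ‖p.1‖ ‖p.2‖ with h | h <;> rw [Prod.norm_def, h, Real.norm_eq_abs, habs]
    · have : l * min w w⁻¹ / 8 * p.1 ^ 4 ≤ l * w / 8 * p.1 ^ 4 := by
        gcongr; exact min_le_left _ _
      linarith
    · have : l * min w w⁻¹ / 8 * p.2 ^ 4 ≤ l * w⁻¹ / 8 * p.2 ^ 4 := by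
        gcongr; exact min_le_right _ _
      linarith
  -- The cubic terms of the function cancel degree three; the `d` and a² terms cancel u³y and uy³.
  -- What remains, l u²y², is only semidefinite, and the last two terms trade part of it for
  -- positive multiples of u⁴ and y⁴. The rest is o(‖p‖⁴).
  have hid : focusLyapunovFst w c d l p * p.2
        + focusLyapunovSnd a w l p * (-f p.1 * p.2 - g p.1)
      = (l / 4 * (p.1 ^ 2 * p.2 ^ 2) + w * l / 8 * p.1 ^ 4 + l * w⁻¹ / 8 * p.2 ^ 4)
        - (S2 p * A3 p + S3 p * A2 p + S3 p * A3 p + focusLyapunovSnd a w l p *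
          ((f p.1 - (a * p.1 + b * p.1 ^ 2)) * p.2
            + (g p.1 - (w * p.1 + c * p.1 ^ 2 + d * p.1 ^ 3)))) := by
    obtain rfl : b = a * c / w - l := by field_simp; linarith
    simp only [hS2, hS3, hA2, hA3, focusLyapunovFst, focusLyapunovSnd]
    field_simp
    ring
  have hnorm : 0 < ‖p‖ ^ 4 := by positivity
  have : l * min w w⁻¹ / 8 * ‖p‖ ^ 4 = 2 * (l * min w w⁻¹ / 16 * ‖p‖ ^ 4) := by ring
  have h4 := mul_pos hk hnorm
  rw [hid]
  linarith

/-! ### The attracting equilibrium for ε > 0 -/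

/-- A quadratic Lyapunov function for the hyperbolic focus or node `u' = y`, `y' = -α y - β u`. -/
theorem exists_quadratic_lyapunov {α β : ℝ} (hα : 0 < α) (hβ : 0 < β) {F G : ℝ → ℝ}
    (hF : ContinuousAt F 0) (hFα : F 0 = α) (hG : HasDerivAt G β 0) (hG0 : G 0 = 0) :
    ∃ κ k : ℝ, 0 < k ∧ (∀ p : ℝ × ℝ, k * ‖p‖ ^ 2 ≤ p.2 ^ 2 + β * p.1 ^ 2 + κ * p.1 * p.2) ∧
      ∀ᶠ p in 𝓝 (0 : ℝ × ℝ), p ≠ 0 →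
        (2 * β * p.1 + κ * p.2) * p.2 + (2 * p.2 + κ * p.1) * (-F p.1 * p.2 - G p.1) < 0 := by
  -- Without a cross term the derivative -2αy² would be only semidefinite. With κuy it is negative
  -- definite for 0 < κ < 8αβ/(α² + 4β); half of this bound also keeps the form itself positive
  -- definite.
  set κ : ℝ := 4 * α * β / (α ^ 2 + 4 * β) with hκ
  have hden : 0 < α ^ 2 + 4 * β := by positivity
  have hκpos : 0 < κ := by positivity
  have hκeq : κ * (α ^ 2 + 4 * β) = 4 * α * β := by rw [hκ]; field_simp
  have hκβ : κ ^ 2 ≤ β := by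
    have h1 : (4 * α * β) ^ 2 ≤ β * (α ^ 2 + 4 * β) ^ 2 := by
      nlinarith [mul_nonneg hβ.le (sq_nonneg (α ^ 2 - 4 * β))]
    rw [← hκeq, mul_pow] at h1
    exact le_of_mul_le_mul_right h1 (by positivity)
  have hκα : κ < α := by
    by_contra! h
    nlinarith [mul_le_mul_of_nonneg_right h hden.le, pow_pos hα 3]
  have hquad : ∀ {A B D : ℝ}, 0 < A → 0 < B → B ^ 2 < A * D →
      ∃ k : ℝ, 0 < k ∧ ∀ p : ℝ × ℝ, k * ‖p‖ ^ 2 ≤ A * p.2 ^ 2 + 2 * B * (p.1 * p.2) + D * p.1 ^ 2 := by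
    intro A B D hA hB hAD
    have hD : 0 < D := by
      by_contra! h
      nlinarith [mul_nonneg hA.le (neg_nonneg.2 h), pow_pos hB 2]
    refine ⟨min ((A * D - B ^ 2) / A) ((A * D - B ^ 2) / D), lt_min ?_ ?_, fun p => ?_⟩
    · exact div_pos (by linarith) hA
    · exact div_pos (by linarith) hD
    · have e1 : A * p.2 ^ 2 + 2 * B * (p.1 * p.2) + D * p.1 ^ 2
          = (A * D - B ^ 2) / A * p.1 ^ 2 + (A * p.2 + B * p.1) ^ 2 / A := by field_simp; ring
      have e2 : A * p.2 ^ 2 + 2 * B * (p.1 * p.2) + D * p.1 ^ 2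
          = (A * D - B ^ 2) / D * p.2 ^ 2 + (D * p.1 + B * p.2) ^ 2 / D := by field_simp; ring
      rcases max_choice ‖p.1‖ ‖p.2‖ with h | h <;> rw [Prod.norm_def, h, Real.norm_eq_abs, sq_abs]
      · rw [e1]
        have := mul_le_mul_of_nonneg_right
          (min_le_left ((A * D - B ^ 2) / A) ((A * D - B ^ 2) / D)) (sq_nonneg p.1)
        have : 0 ≤ (A * p.2 + B * p.1) ^ 2 / A := by positivity
        linarith
      · rw [e2]
        have := mul_le_mul_of_nonneg_right
          (min_le_right ((A * D - B ^ 2) / A) ((A * D - B ^ 2) / D)) (sq_nonneg p.2)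
        have : 0 ≤ (D * p.1 + B * p.2) ^ 2 / D := by positivity
        linarith
  obtain ⟨k, hk, hkle⟩ := hquad (A := 1) (B := κ / 2) (D := β) one_pos (by positivity)
    (by nlinarith)
  obtain ⟨k', hk', hkle'⟩ := hquad (A := 2 * α - κ) (B := κ * α / 2) (D := κ * β) (by linarith)
    (by positivity) (by
      have : 0 < κ * (2 * α * β) := by positivity
      nlinarith [mul_pos hκpos hα])
  refine ⟨κ, k, hk, fun p => (hkle p).trans_eq (by ring), ?_⟩
  have hfst : Tendsto (fun p : ℝ × ℝ => p.1) (𝓝 0) (𝓝 0) := continuous_fst.tendsto' _ _ rfl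
  have hFo : (fun p : ℝ × ℝ => F p.1 - α) =o[𝓝 0] fun _ => (1 : ℝ) := by
    rw [isLittleO_one_iff]
    have : Tendsto (fun p : ℝ × ℝ => F p.1) (𝓝 0) (𝓝 α) := by
      rw [← hFα]; exact hF.tendsto.comp hfst
    simpa using this.sub_const α
  have hGo : (fun p : ℝ × ℝ => G p.1 - β * p.1) =o[𝓝 0] fun p => ‖p‖ := by
    have h1 := (hasDerivAt_iff_isLittleO.1 hG)
    simp only [hG0, sub_zero, smul_eq_mul] at h1
    refine ((h1.comp_tendsto hfst).trans_isBigO isBigO_fst_norm).congr_left fun p => ?_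
    simp [mul_comm]
  have hlin : (fun p : ℝ × ℝ => 2 * p.2 + κ * p.1) =O[𝓝 0] fun p => ‖p‖ :=
    (isBigO_snd_norm.const_mul_left 2).add (isBigO_fst_norm.const_mul_left κ)
  have hrem := hlin.mul_isLittleO (((hFo.mul_isBigO isBigO_snd_norm).congr_right
    (g₂ := fun p : ℝ × ℝ => ‖p‖) fun p => one_mul _).add hGo)
  filter_upwards [hrem.bound (half_pos hk')] with p hp hp0
  have hp1 := (abs_le.1 (Real.norm_eq_abs _ ▸ hp)).1
  have h2 := hkle' p
  have h3 : 0 < k' * ‖p‖ ^ 2 := by positivity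
  rw [← sq, norm_pow, norm_norm] at hp1
  nlinarith

/-! ### From an outer barrier to a cycle -/

/-- Reversing time makes the annulus between the barriers forward invariant and the rotation
counterclockwise, without changing cycles as sets. -/
theorem IsCycle.of_neg {X : ℝ × ℝ → ℝ × ℝ} {C : Set (ℝ × ℝ)} (h : IsCycle (fun p => -X p) C) :
    IsCycle X C := by
  obtain ⟨γ, T, hT, hγ, hper, ⟨t, ht⟩, rfl⟩ := h
  refine ⟨fun s => γ (-s), T, hT, fun s => ?_, fun s => ?_, ⟨-t, by simpa using ht⟩, ?_⟩
  · have := HasDerivAt.scomp s (hγ (-s)) (hasDerivAt_neg s)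
    exact this.congr_deriv (by simp)
  · have := hper (-(s + T))
    rw [show -(s + T) + T = -s by ring] at this
    exact this.symm
  · exact (neg_surjective.range_comp γ).symm

theorem norm_polarPoint_sub_le (c : ℝ × ℝ) {ρ : ℝ} (hρ : 0 ≤ ρ) (θ : ℝ) :
    ‖polarPoint c ρ θ - c‖ ≤ ρ := by
  rw [Prod.norm_def]
  refine max_le ?_ ?_ <;>
    simp only [polarPoint, Prod.fst_sub, Prod.snd_sub, add_sub_cancel_left, Real.norm_eq_abs,
      abs_mul, abs_of_nonneg hρ]
  · exact mul_le_of_le_one_right hρ (Real.abs_cos_le_one θ)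
  · exact mul_le_of_le_one_right hρ (Real.abs_sin_le_one θ)

/-- The norm on the plane is the sup norm, which is at least 1/√2 of the Euclidean one; 1/2 is
enough. -/
theorem half_le_norm_polarPoint_sub (c : ℝ × ℝ) (ρ θ : ℝ) :
    ρ / 2 ≤ ‖polarPoint c ρ θ - c‖ := by
  by_contra! h
  have h1 := (norm_fst_le _).trans_lt h
  have h2 := (norm_snd_le _).trans_lt h
  simp only [polarPoint, Prod.fst_sub, Prod.snd_sub, add_sub_cancel_left, Real.norm_eq_abs]
    at h1 h2
  have h3 := sq_lt_sq' (abs_lt.1 h1).1 (abs_lt.1 h1).2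
  have h4 := sq_lt_sq' (abs_lt.1 h2).1 (abs_lt.1 h2).2
  have h5 := Real.sin_sq_add_cos_sq θ
  have h6 : ρ ^ 2 = (ρ * Real.cos θ) ^ 2 + (ρ * Real.sin θ) ^ 2 := by
    linear_combination -ρ ^ 2 * h5
  nlinarith [sq_nonneg ρ]

theorem isLittleO_sub_taylor {f : ℝ → ℝ} {x₀ : ℝ} {n : ℕ} (hf : ContDiffAt ℝ n f x₀) :
    (fun u => f (x₀ + u) - ∑ k ∈ Finset.range (n + 1), iteratedDeriv k f x₀ / k.factorial * u ^ k)
      =o[𝓝 0] fun u => u ^ n := by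
  obtain ⟨s, hs, hfs⟩ := hf.contDiffOn le_rfl (by simp)
  obtain ⟨η, hη, hball⟩ := Metric.mem_nhds_iff.1 (by simpa using hs)
  have hx : x₀ ∈ Metric.ball x₀ η := Metric.mem_ball_self hη
  have h1 := taylor_isLittleO (convex_ball x₀ η) hx (hfs.mono hball)
  rw [Metric.isOpen_ball.nhdsWithin_eq hx] at h1
  have h2 : Tendsto (fun u : ℝ => x₀ + u) (𝓝 0) (𝓝 x₀) :=
    (continuous_const_add x₀).tendsto' _ _ (by simp)
  refine (h1.comp_tendsto h2).congr (fun u => ?_) (fun u => by simp)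
  simp only [Function.comp_apply, taylor_within_apply, add_sub_cancel_left]
  congr 1
  refine Finset.sum_congr rfl fun k _ => ?_
  rw [iteratedDerivWithin_of_isOpen Metric.isOpen_ball hx, smul_eq_mul]
  ring

/-- Existence of a cycle around an attracting equilibrium `(e, 0)` of the Liénard-type system
`x' = y`, `y' = -F(x) y - G(x)` inside a curve `V = 0` which trajectories cross outwards. -/
theorem exists_cycle_of_outer_barrier {F G : ℝ → ℝ} {e w M : ℝ} (hw : 0 < w) (hM : 0 < M)
    (hF : ∀ x, |x - e| ≤ M → ContDiffAt ℝ 1 F x) (hG : ∀ x, |x - e| ≤ M → ContDiffAt ℝ 1 G x)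
    (hFw : ∀ x, |x - e| ≤ M → F x ^ 2 < 2 * w) (hGw : ∀ x, |x - e| ≤ M → w / 2 ≤ deriv G x)
    (hFe : 0 < F e) (hGe : G e = 0) {V : ℝ × ℝ → ℝ} (hV : Differentiable ℝ V)
    (hVM : ∀ θ, 0 < V (polarPoint (e, 0) M θ)) (hVe : V (e, 0) < 0)
    (hVpos : ∀ p : ℝ × ℝ, ‖p - (e, 0)‖ ≤ M → V p = 0 →
      0 < fderiv ℝ V p (p.2, -F p.1 * p.2 - G p.1)) :
    ∃ C, IsCycle (fun p => (p.2, -F p.1 * p.2 - G p.1)) C ∧ ∀ p ∈ C, ‖p - (e, 0)‖ ≤ M := by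
  set c : ℝ × ℝ := (e, 0) with hc
  have hee : |e - e| ≤ M := by simp [hM.le]
  have hGd : ∀ x, |x - e| ≤ M → HasDerivAt G (deriv G x) x := fun x hx =>
    ((hG x hx).differentiableAt one_ne_zero).hasDerivAt
  have hβ : 0 < deriv G e := (half_pos hw).trans_le (hGw e hee)
  have hG2 : ∀ u, |u| ≤ M → w / 2 * u ^ 2 ≤ u * G (e + u) := by
    intro u hu
    have hconv : Convex ℝ (Icc (e - M) (e + M)) := convex_Icc _ _
    have hmem : ∀ x ∈ Icc (e - M) (e + M), |x - e| ≤ M := fun x hx =>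
      abs_le.2 ⟨by linarith [hx.1], by linarith [hx.2]⟩
    have hmvt := hconv.mul_sub_le_image_sub_of_le_deriv
      (fun x hx => (hGd x (hmem x hx)).continuousAt.continuousWithinAt)
      (fun x hx => (hGd x (hmem x (interior_subset hx))).differentiableAt.differentiableWithinAt)
      (fun x hx => hGw x (hmem x (interior_subset hx)))
    have he : e ∈ Icc (e - M) (e + M) := ⟨by linarith, by linarith⟩
    have heu : e + u ∈ Icc (e - M) (e + M) :=
      ⟨by linarith [(abs_le.1 hu).1], by linarith [(abs_le.1 hu).2]⟩
    rcases le_total 0 u with h | h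
    · have := hmvt e he (e + u) heu (by linarith)
      rw [hGe] at this
      nlinarith
    · have := hmvt (e + u) heu e he (by linarith)
      rw [hGe] at this
      nlinarith
  obtain ⟨κ, k, hk, hkle, hWneg⟩ := exists_quadratic_lyapunov (α := F e) (β := deriv G e)
    (F := fun u => F (e + u)) (G := fun u => G (e + u)) hFe hβ
    (by
      refine ContinuousAt.comp (g := F) (f := fun u => e + u) ?_ (by fun_prop)
      rw [add_zero]; exact (hF e hee).continuousAt)
    (by simp)
    (by
      have h1 : HasDerivAt G (deriv G e) (e + 0) := by rw [add_zero]; exact hGd e hee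
      exact (h1.comp (0 : ℝ) ((hasDerivAt_id (0 : ℝ)).const_add e)).congr_deriv (mul_one _))
    (by simpa using hGe)
  obtain ⟨δ, hδ, hWδ⟩ := Metric.eventually_nhds_iff_ball.1 hWneg
  set Q : ℝ × ℝ → ℝ := fun p => p.2 ^ 2 + deriv G e * p.1 ^ 2 + κ * p.1 * p.2 with hQ
  -- The ellipse through (e + ρ₀, 0) must lie where the quadratic form decreases, and this point
  -- must lie inside the outer curve: it is the admissible starting radius.
  obtain ⟨ρ₀, ⟨hVρ, hρM, hρδ⟩, hρ0⟩ : ∃ ρ₀ : ℝ, (V (e + ρ₀, 0) < 0 ∧ ρ₀ < M ∧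
      deriv G e * ρ₀ ^ 2 < k * δ ^ 2) ∧ 0 < ρ₀ := by
    have h1 : ∀ᶠ ρ in 𝓝 (0 : ℝ), V (e + ρ, 0) < 0 := by
      have : Continuous fun ρ : ℝ => V (e + ρ, 0) := hV.continuous.comp (by fun_prop)
      exact this.continuousAt.eventually (gt_mem_nhds (by simpa using hVe))
    have h2 : ∀ᶠ ρ in 𝓝 (0 : ℝ), deriv G e * ρ ^ 2 < k * δ ^ 2 := by
      have : Continuous fun ρ : ℝ => deriv G e * ρ ^ 2 := by fun_prop
      exact this.continuousAt.eventually (gt_mem_nhds (by simp; positivity))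
    have h3 := h1.and ((gt_mem_nhds hM).and h2)
    exact ((h3.filter_mono (nhdsWithin_le_nhds (s := Ioi 0))).and self_mem_nhdsWithin).exists
  set w₀ : ℝ := deriv G e * ρ₀ ^ 2 with hw₀
  have hw₀pos : 0 < w₀ := by positivity
  have hQc : Continuous Q := by fun_prop
  obtain ⟨η, hη, hQη⟩ := Metric.eventually_nhds_iff_ball.1
    (hQc.continuousAt.eventually (gt_mem_nhds (show Q 0 < w₀ by simpa [hQ] using hw₀pos)))
  set m : ℝ := min (η / 2) ρ₀ with hmdef
  have hm : 0 < m := lt_min (half_pos hη) hρ0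
  have hmρ : m ≤ ρ₀ := min_le_right _ _
  have hnear : ∀ ρ ∈ Icc m M, ∀ θ, ‖polarPoint c ρ θ - c‖ ≤ M := fun ρ hρ θ =>
    (norm_polarPoint_sub_le c (hm.le.trans hρ.1) θ).trans hρ.2
  have habs : ∀ p : ℝ × ℝ, ‖p - c‖ ≤ M → |p.1 - e| ≤ M := fun p hp => (norm_fst_le _).trans hp
  set W : ℝ × ℝ → ℝ := fun p => w₀ - Q (p - c) with hW
  have hWd : Differentiable ℝ W := by simp only [hW, hQ, hc]; fun_prop
  have hWf : ∀ p z : ℝ × ℝ, fderiv ℝ W p z = -((2 * deriv G e * (p.1 - e) + κ * p.2) * z.1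
      + (2 * p.2 + κ * (p.1 - e)) * z.2) := by
    intro p z
    have h1 : HasDerivAt (fun s : ℝ => p + s • z) z 0 := by
      simpa using ((hasDerivAt_id (0 : ℝ)).smul_const z).const_add p
    have hA : HasDerivAt (fun s : ℝ => W (p + s • z)) (fderiv ℝ W p z) 0 := by
      have h2 : HasFDerivAt W (fderiv ℝ W p) (p + (0 : ℝ) • z) := by
        rw [zero_smul, add_zero]; exact (hWd p).hasFDerivAt
      exact h2.comp_hasDerivAt (0 : ℝ) h1
    refine hA.unique ?_
    have hu : HasDerivAt (fun s : ℝ => p.1 + s * z.1 - e) z.1 0 := by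
      simpa using (((hasDerivAt_id (0 : ℝ)).mul_const z.1).const_add p.1).sub_const e
    have hy : HasDerivAt (fun s : ℝ => p.2 + s * z.2 - 0) z.2 0 := by
      simpa using (((hasDerivAt_id (0 : ℝ)).mul_const z.2).const_add p.2)
    have key := (((hy.pow 2).add ((hu.pow 2).const_mul (deriv G e))).add
      ((hu.const_mul κ).mul hy)).const_sub w₀
    refine key.congr_deriv ?_
    norm_num
    ring
  obtain ⟨C, hC, hCm⟩ := exists_cycle_of_barriers (Y := fun p => -(p.2, -F p.1 * p.2 - G p.1))
    (c := c) (m := m) (M := M) (V := V) (W := W) (ρ₀ := ρ₀) hm (hmρ.trans hρM.le)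
    (by
      intro ρ hρ θ
      have hx := habs _ (hnear ρ hρ θ)
      have h1 : ContDiffAt ℝ 1 (fun p : ℝ × ℝ => F p.1) (polarPoint c ρ θ) :=
        (hF _ hx).comp (polarPoint c ρ θ) contDiffAt_fst
      have h2 : ContDiffAt ℝ 1 (fun p : ℝ × ℝ => G p.1) (polarPoint c ρ θ) :=
        (hG _ hx).comp (polarPoint c ρ θ) contDiffAt_fst
      exact (contDiffAt_snd.prodMk ((h1.neg.mul contDiffAt_snd).sub h2)).neg)
    (by
      intro ρ hρ θ
      have hρpos : 0 < ρ := hm.trans_le hρ.1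
      have hx := habs _ (hnear ρ hρ θ)
      have h1 := hG2 (ρ * Real.cos θ) (by simpa [polarPoint, hc] using hx)
      have h2 := hFw _ hx
      have h3 : polarPoint c ρ θ = (e + ρ * Real.cos θ, ρ * Real.sin θ) := by
        simp [polarPoint, hc]
      rw [h3] at h2 ⊢
      simp only [Prod.fst_neg, Prod.snd_neg] at h2 ⊢
      set f := F (e + ρ * Real.cos θ)
      set g := G (e + ρ * Real.cos θ)
      have h4 := Real.sin_sq_add_cos_sq θ
      -- Completing the square in sin² + f sin cos + (w/2) cos², which bounds the reversed field's
      -- angular speed from below; this is where F² < 2w enters.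
      have h5 : 0 < (Real.sin θ + f / 2 * Real.cos θ) ^ 2
          + (w / 2 - f ^ 2 / 4) * Real.cos θ ^ 2 := by
        rcases eq_or_ne (Real.cos θ) 0 with h | h
        · rw [h] at h4 ⊢
          nlinarith
        · have : 0 < (w / 2 - f ^ 2 / 4) * Real.cos θ ^ 2 :=
            mul_pos (by linarith) (by positivity)
          positivity
      have h6 : w / 2 * ρ * Real.cos θ ^ 2 ≤ Real.cos θ * g := by
        refine le_of_mul_le_mul_left ?_ hρpos
        linarith
      have h7 := mul_pos hρpos h5
      linarith)
    hV hWd hVM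
    (by
      intro θ
      refine sub_pos.2 (hQη _ ?_)
      rw [mem_ball_zero_iff]
      exact (norm_polarPoint_sub_le c hm.le θ).trans_lt
        ((min_le_left _ _).trans_lt (half_lt_self hη)))
    (by
      intro ρ hρ θ h0
      rw [map_neg, neg_lt_zero]
      exact hVpos _ (hnear ρ hρ θ) h0)
    (by
      intro ρ hρ θ h0
      set p := polarPoint c ρ θ
      have hQp : Q (p - c) = w₀ := by linarith [show w₀ - Q (p - c) = 0 from h0]
      have hlt : ‖p - c‖ < δ := by
        have h1 := hkle (p - c)
        have h2 : k * ‖p - c‖ ^ 2 < k * δ ^ 2 := (h1.trans_eq hQp).trans_lt hρδ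
        exact lt_of_pow_lt_pow_left₀ 2 hδ.le (lt_of_mul_lt_mul_left h2 hk.le)
      have hne : p - c ≠ 0 := by
        intro h
        rw [h] at hQp
        simp [hQ] at hQp
        linarith
      have h1 := hWδ (p - c) (by simpa using hlt) hne
      rw [map_neg, hWf, neg_neg]
      simpa [hc] using h1)
    ⟨hmρ, hρM.le⟩
    (by
      have : polarPoint c ρ₀ 0 = (e + ρ₀, 0) := by simp [polarPoint, hc]
      rw [this]; exact hVρ.le)
    (by
      have : polarPoint c ρ₀ 0 - c = (ρ₀, 0) := by simp [polarPoint, hc]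
      rw [hW]
      simp only [this]
      simp [hQ, hw₀])
  refine ⟨C, hC.of_neg, fun p hp => ?_⟩
  obtain ⟨ρ, hρ, θ, rfl⟩ := hCm p hp
  exact hnear ρ hρ θ

/-! ### Uniformity in ε and conclusion -/

/-- Holding jointly in (x, ε), these bounds give rotation on a disc whose radius does not shrink
with ε. -/
theorem eventually_damping_and_restoring_bounds {F G : ℝ → ℝ → ℝ} {x₀ : ℝ} {U : Set (ℝ × ℝ)} (hU : IsOpen U)
    (hx₀ : (x₀, (0 : ℝ)) ∈ U) (hF : ContDiffOn ℝ ∞ (fun p : ℝ × ℝ => F p.1 p.2) U)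
    (hG : ContDiffOn ℝ ∞ (fun p : ℝ × ℝ => G p.1 p.2) U) (hF₀ : F x₀ 0 = 0) {w : ℝ} (hw : 0 < w)
    (hGw : deriv (fun x => G x 0) x₀ = w) :
    ∀ᶠ p in 𝓝 (x₀, (0 : ℝ)), p ∈ U ∧ F p.1 p.2 ^ 2 < 2 * w ∧
      w / 2 ≤ deriv (fun x => G x p.2) p.1 := by
  have hUn : U ∈ 𝓝 (x₀, (0 : ℝ)) := hU.mem_nhds hx₀
  have hder : ∀ p ∈ U, deriv (fun x => G x p.2) p.1
      = fderiv ℝ (fun p : ℝ × ℝ => G p.1 p.2) p (1, 0) := by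
    intro p hp
    have h1 : HasFDerivAt (fun p : ℝ × ℝ => G p.1 p.2)
        (fderiv ℝ (fun p : ℝ × ℝ => G p.1 p.2) p) (p.1, p.2) :=
      (((hG p hp).contDiffAt (hU.mem_nhds hp)).differentiableAt (by simp)).hasFDerivAt
    have h2 : HasDerivAt (fun x : ℝ => (x, p.2)) ((1 : ℝ), (0 : ℝ)) p.1 :=
      (hasDerivAt_id p.1).prodMk (hasDerivAt_const _ _)
    exact (HasFDerivAt.comp_hasDerivAt (l := fun p : ℝ × ℝ => G p.1 p.2)
      (f := fun x : ℝ => (x, p.2)) p.1 h1 h2).deriv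
  have hFc : ContinuousAt (fun p : ℝ × ℝ => F p.1 p.2 ^ 2) (x₀, 0) :=
    ((hF _ hx₀).contDiffAt hUn).continuousAt.pow 2
  have hGc : ContinuousAt (fun p => fderiv ℝ (fun p : ℝ × ℝ => G p.1 p.2) p (1, 0)) (x₀, 0) :=
    (((hG _ hx₀).contDiffAt hUn).fderiv_right (m := 0) (by simp)).continuousAt.clm_apply
      continuousAt_const
  have hG0 : w / 2 < fderiv ℝ (fun p : ℝ × ℝ => G p.1 p.2) (x₀, 0) (1, 0) := by
    rw [← hder _ hx₀]
    simp only [hGw]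
    linarith
  filter_upwards [hUn, hFc.eventually (gt_mem_nhds (show F x₀ 0 ^ 2 < 2 * w by rw [hF₀]; linarith)),
    hGc.eventually (lt_mem_nhds hG0)] with p h1 h2 h3
  exact ⟨h1, h2, by rw [hder p h1]; exact h3.le⟩

theorem theorem1 (F G : ℝ → ℝ → ℝ) (f g : ℝ → ℝ) (x₀ : ℝ) (U : Set (ℝ × ℝ))
    (hU : IsOpen U) (hx₀ : (x₀, (0 : ℝ)) ∈ U)
    (hF : ContDiffOn ℝ ∞ (fun p : ℝ × ℝ => F p.1 p.2) U)
    (hG : ContDiffOn ℝ ∞ (fun p : ℝ × ℝ => G p.1 p.2) U)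
    (hf : ∀ x : ℝ, (x, (0 : ℝ)) ∈ U → F x 0 = f x)
    (hg : ∀ x : ℝ, (x, (0 : ℝ)) ∈ U → G x 0 = g x)
    (hf₀ : f x₀ = 0) (hg₀ : g x₀ = 0)
    (hneg : deriv (deriv f) x₀ * deriv g x₀ - deriv (deriv g) x₀ * deriv f x₀ < 0)
    (hpos : 0 < deriv g x₀)
    (xε : ℝ → ℝ) (hxε : Tendsto xε (𝓝[>] 0) (𝓝 x₀))
    (hzero : ∀ᶠ ε in 𝓝[>] (0 : ℝ), G (xε ε) ε = 0)
    (hFpos : ∀ᶠ ε in 𝓝[>] (0 : ℝ), 0 < F (xε ε) ε) :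
    ∀ r : ℝ, 0 < r → ∃ ε₀ : ℝ, 0 < ε₀ ∧ ∀ ε ∈ Set.Ioo (0 : ℝ) ε₀,
      ∃ C : Set (ℝ × ℝ), IsCycle (lienardField F G ε) C ∧
        C ⊆ Metric.ball (xε ε, (0 : ℝ)) r ∧ ∀ p ∈ C, (p.1, ε) ∈ U := by
  intro r hr
  have hFat : ∀ p ∈ U, ContDiffAt ℝ ∞ (fun p : ℝ × ℝ => F p.1 p.2) p := fun p hp =>
    (hF p hp).contDiffAt (hU.mem_nhds hp)
  have hGat : ∀ p ∈ U, ContDiffAt ℝ ∞ (fun p : ℝ × ℝ => G p.1 p.2) p := fun p hp =>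
    (hG p hp).contDiffAt (hU.mem_nhds hp)
  have hslice : ∀ {H : ℝ → ℝ → ℝ} {x ε : ℝ},
      ContDiffAt ℝ ∞ (fun p : ℝ × ℝ => H p.1 p.2) (x, ε) → ContDiffAt ℝ ∞ (fun x => H x ε) x :=
    fun {H x ε} h => ContDiffAt.comp (g := fun p : ℝ × ℝ => H p.1 p.2)
      (f := fun x : ℝ => (x, ε)) x h (contDiffAt_id.prodMk contDiffAt_const)
  have hline : ∀ᶠ x in 𝓝 x₀, (x, (0 : ℝ)) ∈ U := by
    have : Continuous fun x : ℝ => (x, (0 : ℝ)) := by fun_prop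
    exact this.continuousAt.eventually (hU.mem_nhds hx₀)
  have hfe : f =ᶠ[𝓝 x₀] fun x => F x 0 := hline.mono fun x hx => (hf x hx).symm
  have hge : g =ᶠ[𝓝 x₀] fun x => G x 0 := hline.mono fun x hx => (hg x hx).symm
  have hfs : ContDiffAt ℝ ∞ f x₀ := (hslice (hFat _ hx₀)).congr_of_eventuallyEq hfe
  have hgs : ContDiffAt ℝ ∞ g x₀ := (hslice (hGat _ hx₀)).congr_of_eventuallyEq hge
  set w := deriv g x₀ with hw
  set a := deriv f x₀ with ha
  set b := deriv (deriv f) x₀ / 2 with hb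
  set c := deriv (deriv g) x₀ / 2 with hc
  set d := iteratedDeriv 3 g x₀ / 6 with hd
  set l := (a * c - b * w) / w with hl
  have hlpos : 0 < l := div_pos (by rw [hb, hc]; linarith) hpos
  have htf : (fun u => f (x₀ + u) - (a * u + b * u ^ 2)) =o[𝓝 0] fun u => u ^ 2 := by
    refine (isLittleO_sub_taylor (contDiffAt_infty.1 hfs 2)).congr_left
      fun u => ?_
    simp [Finset.sum_range_succ, iteratedDeriv_succ, iteratedDeriv_zero, hf₀, ha, hb]
  have htg : (fun u => g (x₀ + u) - (w * u + c * u ^ 2 + d * u ^ 3)) =o[𝓝 0] fun u => u ^ 3 := by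
    refine (isLittleO_sub_taylor (contDiffAt_infty.1 hgs 3)).congr_left
      fun u => ?_
    simp [Finset.sum_range_succ, iteratedDeriv_succ, iteratedDeriv_zero, hg₀, hw, hc, hd,
      Nat.factorial]
  set V : ℝ × ℝ → ℝ := fun p => focusLyapunov a w c d l (p - (x₀, 0)) with hV
  have hVd : Differentiable ℝ V :=
    (differentiable_focusLyapunov a w c d l).comp (differentiable_id.sub_const _)
  obtain ⟨δ, hδ, hnear⟩ := Metric.eventually_nhds_iff_ball.1 (eventually_damping_and_restoring_bounds hU hx₀
    hF hG (by rw [hf _ hx₀, hf₀]) hpos hge.deriv_eq.symm)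
  obtain ⟨δ', hδ', hVnear⟩ := Metric.eventually_nhds_iff_ball.1
    ((eventually_mul_norm_sq_le_focusLyapunov hpos a c d l).and
      (eventually_focusLyapunov_deriv_pos (b := b) (d := d) hpos hlpos
        (by rw [hl]; field_simp) htf htg))
  set M : ℝ := min r (min δ δ') / 4 with hMdef
  have hM : 0 < M := by positivity
  have hMr : 4 * M ≤ r := by rw [hMdef]; linarith [min_le_left r (min δ δ')]
  have hMδ : 4 * M ≤ δ := by
    rw [hMdef]; linarith [(min_le_right r (min δ δ')).trans (min_le_left _ _)]
  have hMδ' : 4 * M ≤ δ' := by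
    rw [hMdef]; linarith [(min_le_right r (min δ δ')).trans (min_le_right _ _)]
  set k : ℝ := min 1 w / 4 with hk
  have hkpos : 0 < k := by positivity
  -- On the circle of radius `M` about the equilibrium the distance to (x₀, 0) is at least M/2 -
  -- M/4, so `V` ≥ kM²/16 = 2v₀ there.
  set v₀ : ℝ := k * M ^ 2 / 32 with hv₀
  have hv₀pos : 0 < v₀ := by positivity
  set Φ : ℝ → ℝ × ℝ → ℝ := fun ε p => focusLyapunovFst w c d l (p - (x₀, 0)) * p.2
    + focusLyapunovSnd a w l (p - (x₀, 0)) * (-F p.1 ε * p.2 - G p.1 ε) with hΦ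
  have hVf : ∀ ε p, fderiv ℝ (fun p => V p - v₀) p (p.2, -F p.1 ε * p.2 - G p.1 ε) = Φ ε p := by
    intro ε p
    rw [fderiv_sub_const, hV, fderiv_comp_sub, fderiv_focusLyapunov hpos.ne']
  -- Positivity of the derivative cannot persist on a whole disc, as the equilibrium lies in it. On
  -- the level set, which avoids (x₀, 0) because v₀ > 0, it has a compact domain and survives for
  -- small ε.
  set K : Set (ℝ × ℝ) := {p | ‖p - (x₀, 0)‖ ≤ 2 * M ∧ V p = v₀} with hK
  have hKc : IsCompact K := by
    have h1 : K = Metric.closedBall (x₀, 0) (2 * M) ∩ V ⁻¹' {v₀} := by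
      ext p; simp [hK, dist_eq_norm]
    rw [h1]
    exact (isCompact_closedBall _ _).inter_right (isClosed_singleton.preimage hVd.continuous)
  have hKpos : ∀ᶠ ε in 𝓝 (0 : ℝ), ∀ p ∈ K, 0 < Φ ε p := by
    refine hKc.eventually_forall_of_forall_eventually fun p hp => ?_
    have hpx : |p.1 - x₀| ≤ 2 * M := (norm_fst_le _).trans hp.1
    have hpU : (p.1, (0 : ℝ)) ∈ U := (hnear (p.1, 0) (by
      rw [Metric.mem_ball, Prod.dist_eq, dist_self, max_eq_left dist_nonneg, Real.dist_eq]
      linarith)).1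
    have hcont : ContinuousAt (fun z : ℝ × (ℝ × ℝ) => Φ z.1 z.2) (0, p) := by
      have hsw : ContinuousAt (fun z : ℝ × (ℝ × ℝ) => (z.2.1, z.1)) (0, p) := by fun_prop
      have h1 : ContinuousAt (fun z : ℝ × (ℝ × ℝ) => F z.2.1 z.1) (0, p) :=
        ContinuousAt.comp (g := fun p : ℝ × ℝ => F p.1 p.2)
          (f := fun z : ℝ × (ℝ × ℝ) => (z.2.1, z.1)) (hFat _ hpU).continuousAt hsw
      have h2 : ContinuousAt (fun z : ℝ × (ℝ × ℝ) => G z.2.1 z.1) (0, p) :=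
        ContinuousAt.comp (g := fun p : ℝ × ℝ => G p.1 p.2)
          (f := fun z : ℝ × (ℝ × ℝ) => (z.2.1, z.1)) (hGat _ hpU).continuousAt hsw
      have h3 : Continuous fun z : ℝ × (ℝ × ℝ) => focusLyapunovFst w c d l (z.2 - (x₀, 0)) :=
        (continuous_focusLyapunovFst w c d l).comp (by fun_prop)
      have h4 : Continuous fun z : ℝ × (ℝ × ℝ) => focusLyapunovSnd a w l (z.2 - (x₀, 0)) :=
        (continuous_focusLyapunovSnd a w l).comp (by fun_prop)
      have h5 : ContinuousAt (fun z : ℝ × (ℝ × ℝ) => z.2.2) (0, p) := by fun_prop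
      exact (h3.continuousAt.mul h5).add (h4.continuousAt.mul ((h1.neg.mul h5).sub h2))
    refine hcont.eventually (lt_mem_nhds ?_)
    have hne : p - (x₀, 0) ≠ 0 := by
      intro h
      have h1 : V p = v₀ := hp.2
      simp only [hV, h] at h1
      simp [focusLyapunov] at h1
      linarith
    have h1 := (hVnear (p - (x₀, 0)) (by
      rw [mem_ball_zero_iff]; linarith [hp.1])).2 hne
    simp only [Prod.fst_sub, Prod.snd_sub, sub_zero, add_sub_cancel] at h1
    simpa only [hΦ, hf _ hpU, hg _ hpU] using h1
  have hVx : Tendsto (fun ε => V (xε ε, 0)) (𝓝[>] 0) (𝓝 0) := by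
    have h1 : Continuous fun x : ℝ => V (x, 0) := hVd.continuous.comp (by fun_prop)
    have h2 : V (x₀, 0) = 0 := by simp [hV, focusLyapunov]
    have h3 := (h1.tendsto x₀).comp hxε
    rw [h2] at h3
    exact h3
  have hmain : ∀ᶠ ε in 𝓝[>] (0 : ℝ), ∃ C : Set (ℝ × ℝ), IsCycle (lienardField F G ε) C ∧
      C ⊆ Metric.ball (xε ε, (0 : ℝ)) r ∧ ∀ p ∈ C, (p.1, ε) ∈ U := by
    filter_upwards [hzero, hFpos, hVx.eventually (gt_mem_nhds hv₀pos),
      hKpos.filter_mono nhdsWithin_le_nhds,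
      hxε.eventually (Metric.ball_mem_nhds x₀ (show 0 < M / 4 by positivity)),
      nhdsWithin_le_nhds (Metric.ball_mem_nhds (0 : ℝ) hδ)] with ε h0 hFe hVe hKε hxe hεδ
    rw [Real.dist_eq] at hxe
    have hloc : ∀ x, |x - xε ε| ≤ M → (x, ε) ∈ Metric.ball (x₀, (0 : ℝ)) δ := by
      intro x hx
      rw [Metric.mem_ball, Prod.dist_eq]
      refine max_lt ?_ hεδ
      have := dist_triangle x (xε ε) x₀
      simp only [Real.dist_eq] at this ⊢
      linarith
    have hshift : ‖((xε ε, 0) : ℝ × ℝ) - (x₀, 0)‖ < M / 4 := by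
      simpa [Prod.norm_def] using hxe
    obtain ⟨C, hC, hCM⟩ := exists_cycle_of_outer_barrier (F := fun x => F x ε)
      (G := fun x => G x ε) (e := xε ε) (V := fun p => V p - v₀) hpos hM
      (fun x hx => (hslice (hFat _ (hnear _ (hloc x hx)).1)).of_le (by simp))
      (fun x hx => (hslice (hGat _ (hnear _ (hloc x hx)).1)).of_le (by simp))
      (fun x hx => (hnear _ (hloc x hx)).2.1) (fun x hx => (hnear _ (hloc x hx)).2.2) hFe h0
      (hVd.sub_const v₀)
      (by
        intro θ
        set p := polarPoint (xε ε, 0) M θ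
        have h1 := half_le_norm_polarPoint_sub (xε ε, 0) M θ
        have h2 := norm_polarPoint_sub_le (xε ε, 0) hM.le θ
        have h3 : p - (x₀, 0) = (p - (xε ε, 0)) + (((xε ε, 0) : ℝ × ℝ) - (x₀, 0)) := by abel
        have h4 := norm_add_le (p - (xε ε, 0)) (((xε ε, 0) : ℝ × ℝ) - (x₀, 0))
        have h5 := norm_sub_le_norm_add (p - (xε ε, 0)) (((xε ε, 0) : ℝ × ℝ) - (x₀, 0))
        rw [← h3] at h4 h5
        have h6 := (hVnear (p - (x₀, 0)) (by rw [mem_ball_zero_iff]; linarith)).1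
        have h7 : (M / 4) ^ 2 ≤ ‖p - (x₀, 0)‖ ^ 2 := by gcongr; linarith
        have h8 := mul_le_mul_of_nonneg_left h7 hkpos.le
        have h9 : 0 < k * M ^ 2 := by positivity
        have h10 : k * (M / 4) ^ 2 ≤ V p := h8.trans h6
        rw [hv₀]
        linarith)
      (sub_neg.2 hVe)
      (by
        intro p hp hp0
        rw [hVf]
        refine hKε p ⟨?_, sub_eq_zero.1 hp0⟩
        have h3 : p - (x₀, 0) = (p - (xε ε, 0)) + (((xε ε, 0) : ℝ × ℝ) - (x₀, 0)) := by abel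
        rw [h3]
        have h4 := norm_add_le (p - (xε ε, 0)) (((xε ε, 0) : ℝ × ℝ) - (x₀, 0))
        linarith)
    refine ⟨C, hC, fun p hp => ?_, fun p hp => ?_⟩
    · rw [mem_ball_iff_norm]
      linarith [hCM p hp]
    · exact (hnear _ (hloc p.1 ((norm_fst_le _).trans (hCM p hp)))).1
  obtain ⟨ε₀, hε₀, hsub⟩ := mem_nhdsGT_iff_exists_Ioo_subset.1 hmain
  exact ⟨ε₀, hε₀, fun ε hε => hsub hε⟩
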